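/- Let $(Y,\Omega)$ be a closed connected symplectic manifold and let $G=\mathrm{Ham}(Y,\Omega)$ be its group of Hamiltonian diffeomorphisms with the $C^\infty$ topology. Every smooth loop $h:S^1=\mathbb{R}/\mathbb{Z}\to G$ with $h(0)=\mathrm{id}$ is generated by a unique normalized Hamiltonian $H:S^1\times Y\to\mathbb{R}$, i.e. one with $\int_Y H(t,\cdot)\,\Omega^n=0$ for all $t$, where $\dim Y=2n$; put $\mathrm{length}(h)=\int_0^1\max_{y\in Y}|H(t,y)|\,dt$. For $\gamma\in\pi_1(G)$ let $\|\gamma\|$ be the infimum of $\mathrm{length}(h)$ over all smooth loops $h$ representing $\gamma$, and let $\|\gamma\|_\infty=\lim_{k\to\infty}\frac1k\|\gamma^k\|$. Suppose that $\gamma\in\pi_1(G)$ is represented by a minimal closed geodesic $h$, that is, by a nonconstant smooth loop $h$ whose length is minimal among all smooth loops representing $\gamma$. Then: 1. The limit defining $\|\gamma\|_\infty$ exists, and $\|\gamma\|_\infty<\|\gamma\|$. 2. For all sufficiently large $N$ the iterated loop $t\mapsto h(Nt)$, which represents $\gamma^N$ and has length $N\,\mathrm{length}(h)$, is not minimal: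 there is a smooth loop representing $\gamma^N$ of strictly smaller length. 3. Such a shortening can be obtained as follows. There are a sequence $g_1,g_2,\dots\in G$ and $N_0$ such that, with $\varphi_0=\mathrm{id}$, $\varphi_k^{-1}\varphi_{k-1}=g_k$ for $k\ge1$, and $h_k(t)=\varphi_k\,h(t)^{-1}\varphi_k^{-1}$, for every $N\ge N_0$ the map $f_N(t)=h_0(t)\circ\dots\circ h_{N-1}(t)$ is a smooth loop in $G$ which represents $\gamma^{-N}$ and satisfies $\mathrm{length}(f_N)<N\,\mathrm{length}(h)$. -/

import Mathlib

open scoped Manifold ContDiff Topology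
open MeasureTheory Filter

noncomputable section

namespace Hofer

/-- The model space `ℝ^{2n}`. -/
abbrev Model (n : ℕ) : Type := EuclideanSpace ℝ (Fin (2 * n))

section Manifold

variable (n : ℕ) (Y : Type*) [TopologicalSpace Y] [ChartedSpace (Model n) Y]

/-- The smooth charts of `Y` (all charts of the maximal smooth atlas). -/
abbrev charts : Set (OpenPartialHomeomorph Y (Model n)) :=
  IsManifold.maximalAtlas (𝓡 (2 * n)) ∞ Y

/-- Smooth diffeomorphisms of `Y`. -/
abbrev Diffeo : Type _ := Y ≃ₘ^∞⟮𝓡 (2 * n), 𝓡 (2 * n)⟯ Y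

/-- Diffeomorphisms form a group under composition, `(f * g) y = f (g y)`. -/
instance : Group (Diffeo n Y) where
  mul f g := g.trans f
  one := Diffeomorph.refl _ _ _
  inv f := f.symm
  mul_assoc _ _ _ := rfl
  one_mul _ := rfl
  mul_one _ := rfl
  inv_mul_cancel f := Diffeomorph.ext fun y => f.symm_apply_apply y

/-- A subbasic neighbourhood of `f` in the `C^∞` topology: all `g` mapping `K` into the domain of
the chart `e'`, whose expression in the charts `e`, `e'` is `ε`-close to that of `f` on `K`
together with all derivatives of order at most `r`. -/
def subbasicNhd (f : Diffeo n Y) (e e' : OpenPartialHomeomorph Y (Model n)) (K : Set Y) (r : ℕ)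
    (ε : ℝ) : Set (Diffeo n Y) :=
  {g | Set.MapsTo g K e'.source ∧ ∀ j ≤ r, ∀ x ∈ e '' K,
    ‖iteratedFDeriv ℝ j (fun u => e' (g (e.symm u))) x
      - iteratedFDeriv ℝ j (fun u => e' (f (e.symm u))) x‖ < ε}

/-- The `C^∞` topology on the group of diffeomorphisms (`Y` compact): uniform convergence of all
derivatives in charts. -/
instance : TopologicalSpace (Diffeo n Y) :=
  TopologicalSpace.generateFrom
    {V | ∃ (f : Diffeo n Y) (e e' : OpenPartialHomeomorph Y (Model n)) (K : Set Y) (r : ℕ) (ε : ℝ),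
      e ∈ charts n Y ∧ e' ∈ charts n Y ∧ IsCompact K ∧ K ⊆ e.source ∧
      Set.MapsTo f K e'.source ∧ 0 < ε ∧ V = subbasicNhd n Y f e e' K r ε}

end Manifold

variable {n : ℕ} {Y : Type*} [TopologicalSpace Y] [ChartedSpace (Model n) Y]

/-- The expression of a differential 2-form in a chart: its pullback to the model space by the
inverse of the chart (meaningful on `e.target`). -/
def localForm (σ : ∀ y : Y, TangentSpace (𝓡 (2 * n)) y [⋀^Fin 2]→L[ℝ] ℝ)
    (e : OpenPartialHomeomorph Y (Model n)) (u : Model n) : Model n [⋀^Fin 2]→L[ℝ] ℝ :=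
  (σ (e.symm u)).compContinuousLinearMap
    (mfderiv (𝓡 (2 * n)) (𝓡 (2 * n)) e.symm u :
      Model n →L[ℝ] TangentSpace (𝓡 (2 * n)) (e.symm u))

variable (n Y) in
/-- A symplectic form: a smooth, closed, nondegenerate differential 2-form. -/
structure SymplecticForm where
  form : ∀ y : Y, TangentSpace (𝓡 (2 * n)) y [⋀^Fin 2]→L[ℝ] ℝ
  smooth : ∀ e ∈ charts n Y, ContDiffOn ℝ ∞ (localForm form e) e.target
  closed : ∀ e ∈ charts n Y, ∀ u ∈ e.target, extDeriv (localForm form e) u = 0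
  nondegenerate : ∀ (y : Y) (v : TangentSpace (𝓡 (2 * n)) y),
    (∀ w : TangentSpace (𝓡 (2 * n)) y, form y ![v, w] = 0) → v = 0

/-- The density `√|det (Ω(∂ᵢ, ∂ⱼ))|` of the Liouville volume form `Ωⁿ / n!` in a chart. -/
def liouvilleDensity (Ω : SymplecticForm n Y) (e : OpenPartialHomeomorph Y (Model n))
    (u : Model n) : ℝ :=
  √|(Matrix.of fun i j : Fin (2 * n) =>
    localForm Ω.form e u ![EuclideanSpace.single i 1, EuclideanSpace.single j 1]).det|

/-- The part of the Liouville measure that sits on the domain of the chart `e`. -/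
def chartMeasure [MeasurableSpace Y] (Ω : SymplecticForm n Y)
    (e : OpenPartialHomeomorph Y (Model n)) : Measure Y :=
  (((volume : Measure (Model n)).restrict e.target).withDensity
    fun u => ENNReal.ofReal (liouvilleDensity Ω e u)).map e.symm

/-- The canonical (Liouville) measure of `(Y, Ω)`. The measures `chartMeasure Ω e` agree on overlaps
of charts by the change of variables formula, so that their supremum is the measure which restricts
to `chartMeasure Ω e` on the domain of every chart `e`. -/
def liouville [MeasurableSpace Y] (Ω : SymplecticForm n Y) : Measure Y :=
  ⨆ e ∈ charts n Y, chartMeasure Ω e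

/-- The path `t ↦ h t` of diffeomorphisms is smooth (jointly in time and space) and is generated by
the smooth time-dependent Hamiltonian `H`: `d/dt (h t y) = X_{H t} (h t y)`, where the Hamiltonian
vector field `X_F` of a function `F` is determined by `Ω(X_F, ·) = -dF`. -/
structure Generates (Ω : SymplecticForm n Y) (H : ℝ → Y → ℝ) (h : ℝ → Diffeo n Y) : Prop where
  smooth_path : ContMDiff (𝓘(ℝ, ℝ).prod (𝓡 (2 * n))) (𝓡 (2 * n)) ∞ fun p : ℝ × Y => h p.1 p.2
  smooth_ham : ContMDiff (𝓘(ℝ, ℝ).prod (𝓡 (2 * n))) 𝓘(ℝ, ℝ) ∞ fun p : ℝ × Y => H p.1 p.2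
  hamilton_eq : ∀ (t : ℝ) (y : Y) (w : TangentSpace (𝓡 (2 * n)) (h t y)),
    Ω.form (h t y)
      ![(mfderiv 𝓘(ℝ, ℝ) (𝓡 (2 * n)) (fun s : ℝ => h s y) t : ℝ →L[ℝ] _) 1, w] =
    -(mfderiv (𝓡 (2 * n)) 𝓘(ℝ, ℝ) (H t) (h t y) : _ →L[ℝ] ℝ) w

/-- `G`: the Hamiltonian diffeomorphisms of `(Y, Ω)`, i.e. those which can be included into
a time-dependent Hamiltonian flow. -/
def Ham (Ω : SymplecticForm n Y) : Type _ :=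
  {φ : Diffeo n Y //
    ∃ (H : ℝ → Y → ℝ) (h : ℝ → Diffeo n Y), Generates Ω H h ∧ h 0 = 1 ∧ h 1 = φ}

/-- `G` carries the `C^∞` topology. -/
instance (Ω : SymplecticForm n Y) : TopologicalSpace (Ham Ω) :=
  inferInstanceAs (TopologicalSpace (Subtype (α := Diffeo n Y) _))

/-- The identity. -/
instance (Ω : SymplecticForm n Y) : One (Ham Ω) where
  one := ⟨1, fun _ _ => 0, fun _ => 1,
    { smooth_path := contMDiff_snd
      smooth_ham := contMDiff_const
      hamilton_eq := fun t y w => by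
        have h0 : (mfderiv 𝓘(ℝ, ℝ) (𝓡 (2 * n)) (fun _ : ℝ => (1 : Diffeo n Y) y) t) = 0 :=
          mfderiv_const
        have h1 : (mfderiv (𝓡 (2 * n)) 𝓘(ℝ, ℝ) (fun _ : Y => (0 : ℝ)) ((1 : Diffeo n Y) y)) = 0 :=
          mfderiv_const
        rw [h0, h1]
        refine ((Ω.form ((1 : Diffeo n Y) y)).map_coord_zero 0 rfl).trans ?_
        exact neg_zero.symm }, rfl, rfl⟩

/-- A smooth loop `S¹ = ℝ/ℤ → G` based at the identity, together with its (unique) normalized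
Hamiltonian function `H : S¹ × Y → ℝ`, `∫_Y H(t, ·) = 0` for all `t`. -/
structure HamLoop [MeasurableSpace Y] (Ω : SymplecticForm n Y) where
  loop : ℝ → Ham Ω
  ham : ℝ → Y → ℝ
  generates : Generates Ω ham fun t => (loop t).1
  loop_periodic : ∀ t, loop (t + 1) = loop t
  ham_periodic : ∀ t, ham (t + 1) = ham t
  loop_zero : loop 0 = 1
  normalized : ∀ t, ∫ y, ham t y ∂(liouville Ω) = 0

variable [MeasurableSpace Y] {Ω : SymplecticForm n Y}

/-- The Hofer length `∫₀¹ max_y |H(t, y)| dt`. -/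
def HamLoop.length (h : HamLoop Ω) : ℝ := ∫ t in (0 : ℝ)..1, ⨆ y : Y, |h.ham t y|

/-- The loop `h` represents the class `γ ∈ π₁(G)`. -/
def HamLoop.Represents (h : HamLoop Ω) (γ : FundamentalGroup (Ham Ω) 1) : Prop :=
  ∃ p : Path (1 : Ham Ω) 1, (∀ t : unitInterval, p t = h.loop t) ∧
    FundamentalGroup.fromPath (Path.Homotopic.Quotient.mk p) = γ

/-- Hofer's norm `‖γ‖`: the infimum of the lengths of the smooth loops representing `γ`. -/
def hoferNorm (γ : FundamentalGroup (Ham Ω) 1) : ℝ :=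
  sInf {ℓ : ℝ | ∃ h : HamLoop Ω, h.Represents γ ∧ h.length = ℓ}

/-- Asymptotic Hofer's norm `‖γ‖_∞ = lim ‖γ^k‖ / k`. -/
def asymptoticHoferNorm (γ : FundamentalGroup (Ham Ω) 1) : ℝ :=
  limUnder atTop fun k : ℕ => hoferNorm (γ ^ k) / k

/-- `h` is a minimal closed geodesic in the class `γ`: a nonconstant loop which represents `γ` and
has the smallest length among all smooth loops representing `γ`. -/
structure HamLoop.IsMinimalGeodesic (h : HamLoop Ω) (γ : FundamentalGroup (Ham Ω) 1) : Prop where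
  represents : h.Represents γ
  minimal : ∀ h' : HamLoop Ω, h'.Represents γ → h.length ≤ h'.length
  nonconstant : ∃ t, h.loop t ≠ 1

/-- `φ_0 = id` and `φ_k⁻¹ φ_{k-1} = g_k` for `k ≥ 1`. -/
def conjugators (g : ℕ → Ham Ω) : ℕ → Diffeo n Y
  | 0 => 1
  | k + 1 => conjugators g k * ((g (k + 1)).1)⁻¹

/-- The loop `f_N(t) = h_0(t) ∘ ⋯ ∘ h_{N-1}(t)` with `h_k(t) = φ_k h(t)⁻¹ φ_k⁻¹`, produced by the
sequential shortening procedure from `h` and the sequence `g`, all rotation angles being zero. -/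
def shortened (h : HamLoop Ω) (g : ℕ → Ham Ω) : ℕ → ℝ → Diffeo n Y
  | 0, _ => 1
  | N + 1, t => shortened h g N t *
      (conjugators g N * ((h.loop t).1)⁻¹ * (conjugators g N)⁻¹)

end Hofer

end

/-!
The Hamiltonian of a product of Hamiltonian paths is the sum of the first Hamiltonian and the second
one transported by the first path, and the Hamiltonian of the inverse path is minus the transported
Hamiltonian. Hence the Hamiltonian of `f_N = h_0 ⋯ h_{N-1}` at `(t, y)` is `-∑_{k < N} H(t, z_k)`,
where `z_0 = h(t) y` and `z_k = h(t) g_k z_{k-1}` (`shortenedLoop_ham`), so that its absolute value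
is at most `N` times the maximum of `|H(t, ·)|`. For the length of `f_N` to be strictly smaller than
`N` times that of `h` it is enough that, for a single `t₀`, every sequence of sample points `z_k`
enters within a bounded number of steps the open set `U` where `|H(t₀, ·)|` is not maximal
(`length_shortenedLoop_lt`). Choosing `g_k = h(t₀)⁻¹ ψ_k ψ_{k-1}⁻¹` makes `z_k = ψ_k h(t₀) y`, so
one needs finitely many Hamiltonian diffeomorphisms `ψ_k` such that the sets `ψ_k⁻¹ U` cover `Y`
(`exists_isHam_cover`).

A nonconstant loop has `H(t₀, ·) ≠ 0` for some `t₀`; as `H(t₀, ·)` has mean zero, it vanishes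
somewhere on the connected manifold `Y`, so `U` is not empty. By compactness, the cover exists as
soon as the Hamiltonian group moves every point into `U` (`exists_isHam_apply_mem`). This holds
because a point can be pushed in any direction by the flow of a Hamiltonian supported in a chart
(`exists_hamiltonian_path_with_velocity`), for which the smoothness of flows of compactly supported
vector fields is derived from the implicit function theorem in a space of curves (`exists_flow`).

That products, inverses and conjugates of loops are again normalized Hamiltonian loops rests on two
facts: Hamiltonian flows preserve the symplectic form (`Generates.isSymplectic`: the pullback of `Ω`
to space-time is closed, and its contraction with `∂/∂t` is exact in space), and symplectic
diffeomorphisms preserve the Liouville measure (`IsSymplectic.map_liouville`), which is finite and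
nonzero. In `π₁`, pointwise products of loops represent products (`HamLoop.cls_mul`), conjugation by
a Hamiltonian diffeomorphism does not matter (`HamLoop.cls_conj`), and `t ↦ h(mt)` represents the
`m`-th power (`HamLoop.cls_speed`); thus `f_N` represents `γ^{-N}`, and `f_N` reversed represents
`γ^N` with the same length.

Finally, `k ↦ ‖γ^k‖` is subadditive, so by Fekete's lemma `‖γ^k‖ / k` converges to its infimum over
`k ≥ 1`, and the infimum is less than `‖γ‖ = length h` because `‖γ^N‖ ≤ length f_N < N length h` for
one `N ≥ 1`.
-/

noncomputable section

namespace Hofer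

variable {n : ℕ} {Y : Type*} [TopologicalSpace Y] [ChartedSpace (Model n) Y]

/-! ### Smooth families of diffeomorphisms -/

section Families

variable {P Q : Type*} [NormedAddCommGroup P] [NormedSpace ℝ P]
  [NormedAddCommGroup Q] [NormedSpace ℝ Q]

/-- A family of diffeomorphisms parametrised by a normed space is smooth if it is smooth jointly in
the parameter and the point. -/
def SmoothFamily (L : P → Diffeo n Y) : Prop :=
  ContMDiff (𝓘(ℝ, P).prod (𝓡 (2 * n))) (𝓡 (2 * n)) ∞ fun p : P × Y => L p.1 p.2

/-- The expression in the charts `e`, `e'` of a map `P × Y → Y`; meaningful where `p.2` lies in the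
target of `e` and the image point in the source of `e'`. -/
def chartRep (F : P × Y → Y) (e e' : OpenPartialHomeomorph Y (Model n)) (p : P × Model n) :
    Model n :=
  e' (F (p.1, e.symm p.2))

lemma contMDiffAt_chart {e : OpenPartialHomeomorph Y (Model n)} (he : e ∈ charts n Y) {y : Y}
    (hy : y ∈ e.source) : ContMDiffAt (𝓡 (2 * n)) (𝓡 (2 * n)) ∞ e y :=
  (contMDiffOn_of_mem_maximalAtlas he).contMDiffAt (e.open_source.mem_nhds hy)

lemma contMDiffAt_chart_symm {e : OpenPartialHomeomorph Y (Model n)} (he : e ∈ charts n Y)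
    {u : Model n} (hu : u ∈ e.target) : ContMDiffAt (𝓡 (2 * n)) (𝓡 (2 * n)) ∞ e.symm u :=
  (contMDiffOn_symm_of_mem_maximalAtlas he).contMDiffAt (e.open_target.mem_nhds hu)

lemma mdiffAt_chart {e : OpenPartialHomeomorph Y (Model n)} (he : e ∈ charts n Y) {y : Y}
    (hy : y ∈ e.source) : MDifferentiableAt (𝓡 (2 * n)) (𝓡 (2 * n)) e y :=
  (contMDiffAt_chart he hy).mdifferentiableAt (by simp)

lemma mdiffAt_chart_symm {e : OpenPartialHomeomorph Y (Model n)} (he : e ∈ charts n Y)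
    {u : Model n} (hu : u ∈ e.target) :
    MDifferentiableAt (𝓡 (2 * n)) (𝓡 (2 * n)) e.symm u :=
  (contMDiffAt_chart_symm he hu).mdifferentiableAt (by simp)

lemma contMDiffAt_lift_chart_symm {e : OpenPartialHomeomorph Y (Model n)} (he : e ∈ charts n Y)
    {p : P × Model n} (hp : p.2 ∈ e.target) :
    ContMDiffAt (𝓘(ℝ, P).prod (𝓡 (2 * n))) (𝓘(ℝ, P).prod (𝓡 (2 * n))) ∞
      (fun q : P × Model n => (q.1, e.symm q.2)) p :=
  contMDiffAt_fst.prodMk ((contMDiffAt_chart_symm he hp).comp p contMDiffAt_snd)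

lemma contDiffAt_comp_chart_symm {E : Type*} [NormedAddCommGroup E] [NormedSpace ℝ E]
    {F : P × Y → E} {e : OpenPartialHomeomorph Y (Model n)} (he : e ∈ charts n Y)
    {p : P × Model n} (hp : p.2 ∈ e.target)
    (hF : ContMDiffAt (𝓘(ℝ, P).prod (𝓡 (2 * n))) 𝓘(ℝ, E) ∞ F (p.1, e.symm p.2)) :
    ContDiffAt ℝ ∞ (fun q : P × Model n => F (q.1, e.symm q.2)) p := by
  have := ContMDiffAt.comp (I := 𝓘(ℝ, P).prod (𝓡 (2 * n))) (g := F)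
    (f := fun q : P × Model n => (q.1, e.symm q.2)) p hF (contMDiffAt_lift_chart_symm he hp)
  rw [← contMDiffAt_iff_contDiffAt, modelWithCornersSelf_prod, ← chartedSpaceSelf_prod]
  exact this

lemma contDiffAt_chartRep {F : P × Y → Y} {e e' : OpenPartialHomeomorph Y (Model n)}
    (he : e ∈ charts n Y) (he' : e' ∈ charts n Y) {p : P × Model n} (hp : p.2 ∈ e.target)
    (hp' : F (p.1, e.symm p.2) ∈ e'.source)
    (hF : ContMDiffAt (𝓘(ℝ, P).prod (𝓡 (2 * n))) (𝓡 (2 * n)) ∞ F (p.1, e.symm p.2)) :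
    ContDiffAt ℝ ∞ (chartRep F e e') p :=
  contDiffAt_comp_chart_symm (F := fun q => e' (F q)) he hp
    ((contMDiffAt_chart he' hp').comp (p.1, e.symm p.2) hF)

namespace SmoothFamily

variable {L K : P → Diffeo n Y}

lemma comp (hL : SmoothFamily L) {σ : Q → P} (hσ : ContDiff ℝ ∞ σ) :
    SmoothFamily fun q => L (σ q) :=
  ContMDiff.comp (g := fun p : P × Y => L p.1 p.2) (f := fun p : Q × Y => (σ p.1, p.2)) hL
    ((hσ.contMDiff.comp contMDiff_fst).prodMk contMDiff_snd)

lemma mul (hL : SmoothFamily L) (hK : SmoothFamily K) : SmoothFamily fun p => L p * K p :=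
  ContMDiff.comp (g := fun p : P × Y => L p.1 p.2) (f := fun p : P × Y => (p.1, K p.1 p.2)) hL
    (contMDiff_fst.prodMk hK)

lemma const (φ : Diffeo n Y) : SmoothFamily fun _ : P => φ :=
  φ.contMDiff_toFun.comp contMDiff_snd

lemma contDiffAt_chartRep (hL : SmoothFamily L) {e e' : OpenPartialHomeomorph Y (Model n)}
    (he : e ∈ charts n Y) (he' : e' ∈ charts n Y) {p : P × Model n} (hp : p.2 ∈ e.target)
    (hp' : L p.1 (e.symm p.2) ∈ e'.source) :
    ContDiffAt ℝ ∞ (chartRep (fun q : P × Y => L q.1 q.2) e e') p :=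
  Hofer.contDiffAt_chartRep he he' hp hp' hL.contMDiffAt

end SmoothFamily

/-- The partial derivatives of every order in the second variable are smooth in both variables. -/
lemma contDiffAt_iteratedFDeriv_partial {E F : Type*} [NormedAddCommGroup E] [NormedSpace ℝ E]
    [NormedAddCommGroup F] [NormedSpace ℝ F] {f : P × E → F} {p : P × E}
    (hf : ContDiffAt ℝ ∞ f p) (j : ℕ) :
    ContDiffAt ℝ ∞ (fun q : P × E => iteratedFDeriv ℝ j (fun u => f (q.1, u)) q.2) p := by
  induction j with
  | zero =>
    simp only [iteratedFDeriv_zero_eq_comp, Function.comp_def]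
    exact (continuousMultilinearCurryFin0 ℝ E F).symm.contDiff.contDiffAt.comp p hf
  | succ j ih =>
    simp only [iteratedFDeriv_succ_eq_comp_left, Function.comp_def]
    refine (LinearIsometryEquiv.contDiff (𝕜 := ℝ) (E := E →L[ℝ] E [×j]→L[ℝ] F)
      (F := E [×(j + 1)]→L[ℝ] F) (continuousMultilinearCurryLeftEquiv ℝ
        (fun _ : Fin (j + 1) => E) F).symm).contDiffAt.comp p ?_
    refine ContDiffAt.fderiv (n := ∞) (f := fun (q : P × E) (u : E) =>
      iteratedFDeriv ℝ j (fun u => f (q.1, u)) u) (g := Prod.snd) ?_ contDiffAt_snd (by simp)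
    exact ContDiffAt.comp (p, p.2) (g := fun q : P × E =>
      iteratedFDeriv ℝ j (fun u => f (q.1, u)) q.2)
      (f := fun r : (P × E) × E => (r.1.1, r.2)) ih (by fun_prop)

/-- A smooth family is continuous for the `C^∞` topology: on a compact set, the derivatives in
charts depend continuously on the parameter, uniformly in the point. -/
lemma SmoothFamily.continuous {L : P → Diffeo n Y} (hL : SmoothFamily L) : Continuous L := by
  refine continuous_generateFrom_iff.2 ?_
  rintro _ ⟨f, e, e', K, r, ε, he, he', hK, hKe, hfK, hε, rfl⟩
  rw [isOpen_iff_mem_nhds]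
  rintro τ ⟨hτK, hτ⟩
  have h1 : ∀ᶠ σ in 𝓝 τ, ∀ y ∈ K, L σ y ∈ e'.source :=
    hK.eventually_forall_of_forall_eventually fun y hy =>
      (ContMDiff.continuous hL).continuousAt.eventually (e'.open_source.mem_nhds (hτK hy))
  have hK' : IsCompact (e '' K) := hK.image_of_continuousOn (e.continuousOn.mono hKe)
  have hmem : ∀ x ∈ e '' K, x ∈ e.target ∧ e.symm x ∈ K := by
    rintro _ ⟨y, hy, rfl⟩
    exact ⟨e.map_source (hKe hy), by rwa [e.left_inv (hKe hy)]⟩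
  have h2 : ∀ j ∈ Finset.range (r + 1), ∀ᶠ σ in 𝓝 τ, ∀ x ∈ e '' K,
      ‖iteratedFDeriv ℝ j (fun u => e' (L σ (e.symm u))) x
        - iteratedFDeriv ℝ j (fun u => e' (f (e.symm u))) x‖ < ε := by
    intro j hj
    refine hK'.eventually_forall_of_forall_eventually fun x hx => ?_
    obtain ⟨hxt, hxK⟩ := hmem x hx
    have c1 := (contDiffAt_iteratedFDeriv_partial (hL.contDiffAt_chartRep (p := (τ, x)) he he' hxt
      (hτK hxK)) j).continuousAt
    have c2 := (contDiffAt_iteratedFDeriv_partial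
      ((SmoothFamily.const (P := P) f).contDiffAt_chartRep (p := (τ, x)) he he' hxt (hfK hxK))
      j).continuousAt
    exact (c1.sub c2).norm.eventually_lt continuousAt_const
      (hτ j (Nat.lt_succ_iff.1 (Finset.mem_range.1 hj)) x hx)
  filter_upwards [h1, (Filter.eventually_all_finset _).2 h2] with σ hσ1 hσ2
  exact ⟨hσ1, fun j hj => hσ2 j (Finset.mem_range.2 (Nat.lt_succ_iff.2 hj))⟩

lemma chartAt_mem_charts [IsManifold (𝓡 (2 * n)) ∞ Y] (y : Y) : chartAt (Model n) y ∈ charts n Y :=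
  IsManifold.chart_mem_maximalAtlas y

/-- The derivative of a diffeomorphism at a point, as an endomorphism of the model space. -/
def der (φ : Diffeo n Y) (y : Y) : Model n →L[ℝ] Model n :=
  mfderiv (𝓡 (2 * n)) (𝓡 (2 * n)) φ y

lemma Diffeo.mdiffAt (φ : Diffeo n Y) (y : Y) :
    MDifferentiableAt (𝓡 (2 * n)) (𝓡 (2 * n)) φ y :=
  φ.contMDiff_toFun.contMDiffAt.mdifferentiableAt (by simp)

lemma der_mul (φ ψ : Diffeo n Y) (y : Y) : der (φ * ψ) y = (der φ (ψ y)).comp (der ψ y) :=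
  mfderiv_comp y (Diffeo.mdiffAt φ (ψ y)) (Diffeo.mdiffAt ψ y)

lemma der_one (y : Y) : der (1 : Diffeo n Y) y = ContinuousLinearMap.id ℝ (Model n) :=
  mfderiv_id

@[simp] lemma Diffeo.mul_apply (φ ψ : Diffeo n Y) (y : Y) : (φ * ψ) y = φ (ψ y) := rfl

@[simp] lemma Diffeo.one_apply (y : Y) : (1 : Diffeo n Y) y = y := rfl

@[simp] lemma Diffeo.inv_apply_apply (φ : Diffeo n Y) (y : Y) : φ⁻¹ (φ y) = y :=
  φ.symm_apply_apply y

@[simp] lemma Diffeo.apply_inv_apply (φ : Diffeo n Y) (y : Y) : φ (φ⁻¹ y) = y :=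
  φ.apply_symm_apply y

lemma der_der_inv (φ : Diffeo n Y) (y : Y) (v : Model n) : der φ (φ⁻¹ y) (der φ⁻¹ y v) = v := by
  have h := der_mul φ φ⁻¹ y
  rw [mul_inv_cancel, der_one] at h
  exact (congrArg (fun A : Model n →L[ℝ] Model n => A v) h).symm

lemma fderiv_comp_inverse {E : Type*} [NormedAddCommGroup E] [NormedSpace ℝ E] {g k : E → E} {u : E}
    (hg : DifferentiableAt ℝ g u) (hk : DifferentiableAt ℝ k (g u))
    (h : ∀ᶠ x in 𝓝 u, k (g x) = x) (v : E) : fderiv ℝ k (g u) (fderiv ℝ g u v) = v := by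
  have h1 := (hk.hasFDerivAt.comp u hg.hasFDerivAt).congr_of_eventuallyEq
    (f₁ := id) (h.mono fun x hx => hx.symm)
  exact (congrArg (fun A : E →L[ℝ] E => A v) (h1.unique (hasFDerivAt_id u)))

/-- The chart expression `u ↦ e' (L p (e.symm u))` is a local diffeomorphism. -/
lemma SmoothFamily.isInvertible_fderiv_chartRep {L : P → Diffeo n Y} (hL : SmoothFamily L)
    {e e' : OpenPartialHomeomorph Y (Model n)}
    (he : e ∈ charts n Y) (he' : e' ∈ charts n Y) {t : P} {y : Y} (hy : y ∈ e.source)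
    (hy' : L t y ∈ e'.source) :
    (fderiv ℝ (fun u => chartRep (fun q : P × Y => L q.1 q.2) e e' (t, u)) (e y)).IsInvertible := by
  have hey : e y ∈ e.target := e.map_source hy
  have hey' : e' (L t y) ∈ e'.target := e'.map_source hy'
  set g : Model n → Model n := fun u => e' (L t (e.symm u)) with hg
  set k : Model n → Model n := fun w => e ((L t)⁻¹ (e'.symm w)) with hk
  have hgy : g (e y) = e' (L t y) := by simp [hg, e.left_inv hy]
  have hky : k (e' (L t y)) = e y := by simp [hk, e'.left_inv hy']
  have dg : ContDiffAt ℝ ∞ g (e y) :=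
    (hL.contDiffAt_chartRep (p := (t, e y)) he he' hey (by simpa [e.left_inv hy] using hy')).comp
      (e y) (contDiffAt_const.prodMk contDiffAt_id)
  have dk : ContDiffAt ℝ ∞ k (e' (L t y)) :=
    ((SmoothFamily.const (P := P) (L t)⁻¹).contDiffAt_chartRep (p := (t, e' (L t y))) he' he hey'
      (by simpa [e'.left_inv hy'] using hy)).comp _ (contDiffAt_const.prodMk contDiffAt_id)
  have hkg : ∀ᶠ u in 𝓝 (e y), k (g u) = u := by
    have c : ContinuousAt (fun u => L t (e.symm u)) (e y) :=
      (L t).continuous.continuousAt.comp (e.symm.continuousAt hey)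
    filter_upwards [e.open_target.mem_nhds hey,
      c (e'.open_source.mem_nhds (by simpa [e.left_inv hy] using hy'))] with u hu hu'
    simp [hk, hg, e'.left_inv hu', e.right_inv hu]
  have hgk : ∀ᶠ w in 𝓝 (e' (L t y)), g (k w) = w := by
    have c : ContinuousAt (fun w => (L t)⁻¹ (e'.symm w)) (e' (L t y)) :=
      ((L t)⁻¹).continuous.continuousAt.comp (e'.symm.continuousAt hey')
    filter_upwards [e'.open_target.mem_nhds hey',
      c (e.open_source.mem_nhds (by simpa [e'.left_inv hy'] using hy))] with w hw hw'
    simp [hk, hg, e.left_inv hw', e'.right_inv hw]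
  have dg1 := dg.differentiableAt (by simp)
  have dk1 := dk.differentiableAt (by simp)
  refine ⟨ContinuousLinearEquiv.equivOfInverse (fderiv ℝ g (e y)) (fderiv ℝ k (e' (L t y)))
    (fun v => ?_) (fun v => ?_), rfl⟩
  · rw [← hgy] at dk1 ⊢
    exact fderiv_comp_inverse dg1 dk1 hkg v
  · rw [← hky] at dg1 ⊢
    exact fderiv_comp_inverse dk1 dg1 hgk v

/-- The inverses of a smooth family form a smooth family, by the implicit function theorem. -/
lemma SmoothFamily.inv [CompleteSpace P] [IsManifold (𝓡 (2 * n)) ∞ Y] {L : P → Diffeo n Y}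
    (hL : SmoothFamily L) : SmoothFamily fun p => (L p)⁻¹ := by
  rintro ⟨t, y'⟩
  obtain ⟨y, rfl⟩ : ∃ y, y' = L t y := ⟨(L t)⁻¹ y', by simp⟩
  set e := chartAt (Model n) y
  set e' := chartAt (Model n) (L t y)
  have he : e ∈ charts n Y := chartAt_mem_charts y
  have he' : e' ∈ charts n Y := chartAt_mem_charts _
  have hy : y ∈ e.source := mem_chart_source _ _
  have hy' : L t y ∈ e'.source := mem_chart_source _ _
  have hey : e y ∈ e.target := e.map_source hy
  set φ := chartRep (fun q : P × Y => L q.1 q.2) e e' with hφ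
  have dφ : ContDiffAt ℝ ∞ φ (t, e y) :=
    hL.contDiffAt_chartRep (p := (t, e y)) he he' hey (by simpa [e.left_inv hy] using hy')
  -- solve `φ (p, u) = w` for `u` as a smooth function `ψ` of `(p, w)`, in charts
  set f : (P × Model n) × Model n → Model n := fun r => φ (r.1.1, r.2) - r.1.2 with hf
  set a : (P × Model n) × Model n := ((t, e' (L t y)), e y) with ha
  have df : ContDiffAt ℝ ∞ f a := by
    refine ContDiffAt.sub ?_ (by fun_prop)
    exact ContDiffAt.comp a (g := φ) (f := fun r : (P × Model n) × Model n => (r.1.1, r.2)) dφ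
      (by fun_prop)
  have hfa : f a = 0 := by simp [hf, ha, hφ, chartRep, e.left_inv hy]
  have hinv : (fderiv ℝ f a ∘L .inr ℝ (P × Model n) (Model n)).IsInvertible := by
    have h1 : HasFDerivAt (fun u : Model n => f ((t, e' (L t y)), u))
        (fderiv ℝ f a ∘L .inr ℝ (P × Model n) (Model n)) (e y) := by
      have h2 : HasFDerivAt (fun u : Model n => (((t, e' (L t y)), u) : (P × Model n) × Model n))
        (.inr ℝ (P × Model n) (Model n)) (e y) := hasFDerivAt_prodMk_right _ _
      exact HasFDerivAt.comp (g := f) (e y) (df.differentiableAt (by simp)).hasFDerivAt h2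
    have h3 := hL.isInvertible_fderiv_chartRep he he' hy hy'
    rw [← h1.fderiv]
    simpa only [hf, fderiv_sub_const] using h3
  set ψ := df.implicitFunction (by simp) hinv
  have hψ0 : ψ a.1 = e y := df.implicitFunction_apply_self (by simp) hinv
  have dψ : ContDiffAt ℝ ∞ ψ a.1 := df.contDiffAt_implicitFunction (by simp) hinv
  have hψ : ∀ᶠ x in 𝓝 a.1, f (x, ψ x) = 0 := by
    simpa [hfa] using df.eventually_apply_implicitFunction (by simp) hinv
  have cl : ContMDiffAt (𝓘(ℝ, P).prod (𝓡 (2 * n))) 𝓘(ℝ, P × Model n) ∞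
      (fun q : P × Y => (q.1, e' q.2)) (t, L t y) :=
    contMDiffAt_fst.prodMk_space ((contMDiffAt_chart he' hy').comp (t, L t y) contMDiffAt_snd)
  have cψ : ContMDiffAt (𝓘(ℝ, P).prod (𝓡 (2 * n))) (𝓡 (2 * n)) ∞
      (fun q : P × Y => ψ (q.1, e' q.2)) (t, L t y) :=
    ContMDiffAt.comp (g := ψ) (t, L t y) (contMDiffAt_iff_contDiffAt.2 dψ) cl
  have cs : ContMDiffAt (𝓘(ℝ, P).prod (𝓡 (2 * n))) (𝓡 (2 * n)) ∞
      (fun q : P × Y => e.symm (ψ (q.1, e' q.2))) (t, L t y) := by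
    refine ContMDiffAt.comp (g := e.symm) (t, L t y) (contMDiffAt_chart_symm he ?_) cψ
    change ψ a.1 ∈ _
    rwa [hψ0]
  -- by injectivity of `e'`, the solution is the inverse diffeomorphism near the given point
  refine cs.congr_of_eventuallyEq ?_
  have e1 : ∀ᶠ q : P × Y in 𝓝 (t, L t y), q.2 ∈ e'.source :=
    continuousAt_snd.eventually (e'.open_source.mem_nhds hy')
  have e2 : ∀ᶠ q : P × Y in 𝓝 (t, L t y), ψ (q.1, e' q.2) ∈ e.target :=
    cψ.continuousAt.eventually (e.open_target.mem_nhds (by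
      change ψ a.1 ∈ _
      rwa [hψ0]))
  have e3 : ∀ᶠ q : P × Y in 𝓝 (t, L t y), L q.1 (e.symm (ψ (q.1, e' q.2))) ∈ e'.source := by
    have c : ContinuousAt (fun q : P × Y => L q.1 (e.symm (ψ (q.1, e' q.2)))) (t, L t y) :=
      ContinuousAt.comp (g := fun q : P × Y => L q.1 q.2)
        (f := fun q : P × Y => (q.1, e.symm (ψ (q.1, e' q.2))))
        (ContMDiff.continuous hL).continuousAt (continuousAt_fst.prodMk cs.continuousAt)
    refine c.eventually (e'.open_source.mem_nhds ?_)
    change L t (e.symm (ψ a.1)) ∈ _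
    rwa [hψ0, e.left_inv hy]
  have e4 := cl.continuousAt.eventually hψ
  filter_upwards [e1, e2, e3, e4] with q h1 h2 h3 h4
  have h5 : e' (L q.1 (e.symm (ψ (q.1, e' q.2)))) = e' q.2 := sub_eq_zero.1 h4
  have h6 := e'.injOn h3 h1 h5
  calc (L q.1)⁻¹ q.2 = (L q.1)⁻¹ (L q.1 (e.symm (ψ (q.1, e' q.2)))) := by rw [h6]
    _ = _ := Diffeo.inv_apply_apply _ _

end Families

/-! ### Hamiltonian flows preserve the symplectic form -/

section Symplectic

/-- The symplectic form at `y`, evaluated on two vectors of the model space, with which every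
tangent space is identified. -/
def SymplecticForm.pair (Ω : SymplecticForm n Y) (y : Y) (v w : Model n) : ℝ := Ω.form y ![v, w]

namespace SymplecticForm

variable (Ω : SymplecticForm n Y) (y : Y)

lemma pair_add_left (v v' w : Model n) : Ω.pair y (v + v') w = Ω.pair y v w + Ω.pair y v' w :=
  (show Model n [⋀^Fin 2]→L[ℝ] ℝ from Ω.form y).vecCons_add ![w] v v'

lemma pair_smul_left (c : ℝ) (v w : Model n) : Ω.pair y (c • v) w = c * Ω.pair y v w :=
  (show Model n [⋀^Fin 2]→L[ℝ] ℝ from Ω.form y).vecCons_smul ![w] c v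

lemma pair_zero_left (w : Model n) : Ω.pair y 0 w = 0 := by
  simpa using Ω.pair_smul_left y 0 0 w

lemma pair_neg_left (v w : Model n) : Ω.pair y (-v) w = -Ω.pair y v w := by
  simpa using Ω.pair_smul_left y (-1) v w

end SymplecticForm

/-- The derivative of the inverse of a chart, as an endomorphism of the model space. -/
def derChartSymm (e : OpenPartialHomeomorph Y (Model n)) (u : Model n) : Model n →L[ℝ] Model n :=
  mfderiv (𝓡 (2 * n)) (𝓡 (2 * n)) e.symm u

/-- The derivative of a chart, as an endomorphism of the model space. -/
def derChart (e : OpenPartialHomeomorph Y (Model n)) (y : Y) : Model n →L[ℝ] Model n :=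
  mfderiv (𝓡 (2 * n)) (𝓡 (2 * n)) e y

/-- The velocity at time `t` of the trajectory of `y` under the path `h` of diffeomorphisms. -/
def velocity (h : ℝ → Diffeo n Y) (t : ℝ) (y : Y) : Model n :=
  (mfderiv 𝓘(ℝ, ℝ) (𝓡 (2 * n)) (fun s : ℝ => h s y) t : ℝ →L[ℝ] Model n) 1

/-- The differential of a function. -/
def differential (F : Y → ℝ) (y : Y) : Model n →L[ℝ] ℝ := mfderiv (𝓡 (2 * n)) 𝓘(ℝ, ℝ) F y

lemma localForm_apply (Ω : SymplecticForm n Y) (e : OpenPartialHomeomorph Y (Model n))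
    (u v w : Model n) :
    localForm Ω.form e u ![v, w] = Ω.pair (e.symm u) (derChartSymm e u v) (derChartSymm e u w) := by
  have : (derChartSymm e u ∘ ![v, w] : Fin 2 → Model n)
      = ![derChartSymm e u v, derChartSymm e u w] := by
    ext i : 1; fin_cases i <;> rfl
  exact congrArg (Ω.form (e.symm u)) this

lemma derChartSymm_derChart {e : OpenPartialHomeomorph Y (Model n)} (he : e ∈ charts n Y) {y : Y}
    (hy : y ∈ e.source) (v : Model n) : derChartSymm e (e y) (derChart e y v) = v := by
  have h1 := mfderiv_comp (I := 𝓡 (2 * n)) (I' := 𝓡 (2 * n)) (I'' := 𝓡 (2 * n)) y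
    (mdiffAt_chart_symm he (e.map_source hy)) (mdiffAt_chart he hy)
  have h2 : (e.symm ∘ e : Y → Y) =ᶠ[𝓝 y] id := by
    filter_upwards [e.open_source.mem_nhds hy] with z hz using e.left_inv hz
  rw [h2.mfderiv_eq, mfderiv_id] at h1
  exact (congrArg (fun A : Model n →L[ℝ] Model n => A v) h1).symm

lemma derChart_derChartSymm {e : OpenPartialHomeomorph Y (Model n)} (he : e ∈ charts n Y)
    {u : Model n} (hu : u ∈ e.target) (v : Model n) :
    derChart e (e.symm u) (derChartSymm e u v) = v := by
  have h1 := mfderiv_comp (I := 𝓡 (2 * n)) (I' := 𝓡 (2 * n)) (I'' := 𝓡 (2 * n)) u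
    (mdiffAt_chart he (e.map_target hu)) (mdiffAt_chart_symm he hu)
  have h2 : (e ∘ e.symm : Model n → Model n) =ᶠ[𝓝 u] id := by
    filter_upwards [e.open_target.mem_nhds hu] with z hz using e.right_inv hz
  rw [h2.mfderiv_eq, mfderiv_id] at h1
  exact (congrArg (fun A : Model n →L[ℝ] Model n => A v) h1).symm

lemma localForm_derChart (Ω : SymplecticForm n Y) {e : OpenPartialHomeomorph Y (Model n)}
    (he : e ∈ charts n Y) {y : Y} (hy : y ∈ e.source) (v w : Model n) :
    localForm Ω.form e (e y) ![derChart e y v, derChart e y w] = Ω.pair y v w := by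
  rw [localForm_apply, derChartSymm_derChart he hy, derChartSymm_derChart he hy, e.left_inv hy]

/-- A diffeomorphism preserving the symplectic form. -/
def IsSymplectic (Ω : SymplecticForm n Y) (φ : Diffeo n Y) : Prop :=
  ∀ y v w, Ω.pair (φ y) (der φ y v) (der φ y w) = Ω.pair y v w

lemma SmoothFamily.mdiffAt_orbit {h : ℝ → Diffeo n Y} (hh : SmoothFamily h) (t : ℝ) (y : Y) :
    MDifferentiableAt 𝓘(ℝ, ℝ) (𝓡 (2 * n)) (fun s => h s y) t :=
  (ContMDiff.comp (g := fun p : ℝ × Y => h p.1 p.2) (f := fun s : ℝ => (s, y)) hh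
    (contMDiff_id.prodMk contMDiff_const)).contMDiffAt.mdifferentiableAt (by simp)

lemma SmoothFamily.fderiv_chartRep_time {h : ℝ → Diffeo n Y} (hh : SmoothFamily h)
    {e e' : OpenPartialHomeomorph Y (Model n)} (he : e ∈ charts n Y) (he' : e' ∈ charts n Y)
    {p : ℝ × Model n} (hp : p.2 ∈ e.target) (hp' : h p.1 (e.symm p.2) ∈ e'.source) :
    fderiv ℝ (chartRep (fun q : ℝ × Y => h q.1 q.2) e e') p (1, 0) =
      derChart e' (h p.1 (e.symm p.2)) (velocity h p.1 (e.symm p.2)) := by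
  obtain ⟨t, u⟩ := p
  have d := (hh.contDiffAt_chartRep he he' hp hp').differentiableAt (by simp)
  have h2 : HasFDerivAt (fun s : ℝ => (s, u)) (.inl ℝ ℝ (Model n)) t := hasFDerivAt_prodMk_left _ _
  have h3 := (HasFDerivAt.comp (g := chartRep (fun q : ℝ × Y => h q.1 q.2) e e') t
    d.hasFDerivAt h2).fderiv
  have h4 := mfderiv_comp (I := 𝓘(ℝ, ℝ)) (I' := 𝓡 (2 * n)) (I'' := 𝓡 (2 * n)) t
    (mdiffAt_chart he' hp') (hh.mdiffAt_orbit t (e.symm u))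
  rw [mfderiv_eq_fderiv] at h4
  have h5 := congrArg (fun A : ℝ →L[ℝ] Model n => A 1) (h3.symm.trans h4)
  exact h5

lemma SmoothFamily.fderiv_chartRep_space {h : ℝ → Diffeo n Y} (hh : SmoothFamily h)
    {e e' : OpenPartialHomeomorph Y (Model n)} (he : e ∈ charts n Y) (he' : e' ∈ charts n Y)
    {p : ℝ × Model n} (hp : p.2 ∈ e.target) (hp' : h p.1 (e.symm p.2) ∈ e'.source) (a : Model n) :
    fderiv ℝ (chartRep (fun q : ℝ × Y => h q.1 q.2) e e') p (0, a) =
      derChart e' (h p.1 (e.symm p.2)) (der (h p.1) (e.symm p.2) (derChartSymm e p.2 a)) := by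
  obtain ⟨t, u⟩ := p
  have d := (hh.contDiffAt_chartRep he he' hp hp').differentiableAt (by simp)
  have h2 : HasFDerivAt (fun x : Model n => (t, x)) (.inr ℝ ℝ (Model n)) u :=
    hasFDerivAt_prodMk_right _ _
  have h3 := (HasFDerivAt.comp (g := chartRep (fun q : ℝ × Y => h q.1 q.2) e e') u
    d.hasFDerivAt h2).fderiv
  have h4 := mfderiv_comp (I := 𝓡 (2 * n)) (I' := 𝓡 (2 * n)) (I'' := 𝓡 (2 * n)) u
    (mdiffAt_chart he' hp') ((Diffeo.mdiffAt (h t) (e.symm u)).comp u (mdiffAt_chart_symm he hp))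
  rw [mfderiv_eq_fderiv, mfderiv_comp (I := 𝓡 (2 * n)) (I' := 𝓡 (2 * n)) (I'' := 𝓡 (2 * n)) u
    (Diffeo.mdiffAt (h t) (e.symm u)) (mdiffAt_chart_symm he hp)] at h4
  exact congrArg (fun A : Model n →L[ℝ] Model n => A a) (h3.symm.trans h4)

variable {Ω : SymplecticForm n Y} {H : ℝ → Y → ℝ} {h : ℝ → Diffeo n Y}

lemma Generates.pair_velocity (g : Generates Ω H h) (t : ℝ) (y : Y) (w : Model n) :
    Ω.pair (h t y) (velocity h t y) w = -differential (H t) (h t y) w :=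
  g.hamilton_eq t y w

/-- `Generates` in terms of vectors of the model space. -/
lemma Generates.of_pair (hh : SmoothFamily h)
    (hH : ContMDiff (𝓘(ℝ, ℝ).prod (𝓡 (2 * n))) 𝓘(ℝ, ℝ) ∞ fun p : ℝ × Y => H p.1 p.2)
    (e : ∀ (t : ℝ) (y : Y) (w : Model n),
      Ω.pair (h t y) (velocity h t y) w = -differential (H t) (h t y) w) : Generates Ω H h :=
  ⟨hh, hH, e⟩

lemma Generates.mdiffAt_ham (g : Generates Ω H h) (t : ℝ) (y : Y) :
    MDifferentiableAt (𝓡 (2 * n)) 𝓘(ℝ, ℝ) (H t) y :=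
  (ContMDiff.comp (g := fun p : ℝ × Y => H p.1 p.2) (f := fun y : Y => (t, y)) g.smooth_ham
    (contMDiff_const.prodMk contMDiff_id)).contMDiffAt.mdifferentiableAt (by simp)

/-- The pullback of the symplectic form to time and space by a path of diffeomorphisms, in
charts. -/
def pullbackForm (Ω : SymplecticForm n Y) (h : ℝ → Diffeo n Y)
    (e e' : OpenPartialHomeomorph Y (Model n)) (p : ℝ × Model n) :
    (ℝ × Model n) [⋀^Fin 2]→L[ℝ] ℝ :=
  (localForm Ω.form e' (chartRep (fun q : ℝ × Y => h q.1 q.2) e e' p)).compContinuousLinearMap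
    (fderiv ℝ (chartRep (fun q : ℝ × Y => h q.1 q.2) e e') p)

lemma pullbackForm_apply (p x y : ℝ × Model n) (e e' : OpenPartialHomeomorph Y (Model n)) :
    pullbackForm Ω h e e' p ![x, y] = localForm Ω.form e'
      (chartRep (fun q : ℝ × Y => h q.1 q.2) e e' p)
      ![fderiv ℝ (chartRep (fun q : ℝ × Y => h q.1 q.2) e e') p x,
        fderiv ℝ (chartRep (fun q : ℝ × Y => h q.1 q.2) e e') p y] := by
  rw [pullbackForm, ContinuousAlternatingMap.compContinuousLinearMap_apply]
  congr 1
  ext i : 1; fin_cases i <;> rfl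

lemma SmoothFamily.pullbackForm_space (hh : SmoothFamily h)
    {e e' : OpenPartialHomeomorph Y (Model n)} (he : e ∈ charts n Y) (he' : e' ∈ charts n Y)
    {p : ℝ × Model n} (hp : p.2 ∈ e.target) (hp' : h p.1 (e.symm p.2) ∈ e'.source)
    (a b : Model n) :
    pullbackForm Ω h e e' p ![(0, a), (0, b)] = Ω.pair (h p.1 (e.symm p.2))
      (der (h p.1) (e.symm p.2) (derChartSymm e p.2 a))
      (der (h p.1) (e.symm p.2) (derChartSymm e p.2 b)) := by
  rw [pullbackForm_apply, hh.fderiv_chartRep_space he he' hp hp',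
    hh.fderiv_chartRep_space he he' hp hp']
  exact localForm_derChart Ω he' hp' _ _

/-- Hamilton's equation in charts: the contraction of the pulled back form with `∂/∂t` is minus the
spatial differential of the pulled back Hamiltonian. -/
lemma Generates.pullbackForm_time (g : Generates Ω H h)
    {e e' : OpenPartialHomeomorph Y (Model n)} (he : e ∈ charts n Y) (he' : e' ∈ charts n Y)
    {p : ℝ × Model n} (hp : p.2 ∈ e.target) (hp' : h p.1 (e.symm p.2) ∈ e'.source)
    (b : Model n) :
    pullbackForm Ω h e e' p ![(1, 0), (0, b)] =
      -fderiv ℝ (fun q : ℝ × Model n => H q.1 (h q.1 (e.symm q.2))) p (0, b) := by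
  have hh : SmoothFamily h := g.smooth_path
  rw [pullbackForm_apply, hh.fderiv_chartRep_space he he' hp hp',
    hh.fderiv_chartRep_time he he' hp hp']
  refine (localForm_derChart Ω he' hp' _ _).trans ?_
  rw [g.pair_velocity, neg_inj]
  obtain ⟨t, u⟩ := p
  have hK : ContMDiff (𝓘(ℝ, ℝ).prod (𝓡 (2 * n))) 𝓘(ℝ, ℝ) ∞ (fun q : ℝ × Y => H q.1 (h q.1 q.2)) :=
    ContMDiff.comp (g := fun p : ℝ × Y => H p.1 p.2) (f := fun p : ℝ × Y => (p.1, h p.1 p.2))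
      g.smooth_ham (contMDiff_fst.prodMk hh)
  have d := (contDiffAt_comp_chart_symm (p := (t, u)) he hp hK.contMDiffAt).differentiableAt
    (by simp)
  have h2 : HasFDerivAt (fun x : Model n => (t, x)) (.inr ℝ ℝ (Model n)) u :=
    hasFDerivAt_prodMk_right _ _
  have h3 := (HasFDerivAt.comp (g := fun q : ℝ × Model n => H q.1 (h q.1 (e.symm q.2))) u
    d.hasFDerivAt h2).fderiv
  have h4 := mfderiv_comp (I := 𝓡 (2 * n)) (I' := 𝓡 (2 * n)) (I'' := 𝓘(ℝ, ℝ)) u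
    (g.mdiffAt_ham t _) ((Diffeo.mdiffAt (h t) (e.symm u)).comp u (mdiffAt_chart_symm he hp))
  rw [mfderiv_eq_fderiv, mfderiv_comp (I := 𝓡 (2 * n)) (I' := 𝓡 (2 * n)) (I'' := 𝓡 (2 * n)) u
    (Diffeo.mdiffAt (h t) (e.symm u)) (mdiffAt_chart_symm he hp)] at h4
  exact (congrArg (fun A : Model n →L[ℝ] ℝ => A b) (h3.symm.trans h4)).symm

/-- In charts, the time derivative of `h_t^* Ω` vanishes: the pulled back form is closed, and its
contraction with `∂/∂t` is spatially exact. -/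
lemma Generates.fderiv_pullbackForm_eq_zero (g : Generates Ω H h)
    {e e' : OpenPartialHomeomorph Y (Model n)} (he : e ∈ charts n Y) (he' : e' ∈ charts n Y)
    {p : ℝ × Model n} (hp : p.2 ∈ e.target) (hp' : h p.1 (e.symm p.2) ∈ e'.source)
    (a b : Model n) :
    DifferentiableAt ℝ (pullbackForm Ω h e e') p ∧
    fderiv ℝ (fun q => pullbackForm Ω h e e' q ![(0, a), (0, b)]) p (1, 0) = 0 := by
  have hh : SmoothFamily h := g.smooth_path
  have two_le : minSmoothness ℝ 2 ≤ (∞ : WithTop ℕ∞) := by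
    rw [minSmoothness_of_isRCLikeNormedField]
    exact WithTop.coe_le_coe.2 (le_top : (2 : ℕ∞) ≤ ⊤)
  set φ := chartRep (fun q : ℝ × Y => h q.1 q.2) e e' with hφ
  have dφ : ContDiffAt ℝ ∞ φ p := hh.contDiffAt_chartRep he he' hp hp'
  have hφt : φ p ∈ e'.target := e'.map_source hp'
  have dω : DifferentiableAt ℝ (localForm Ω.form e') (φ p) :=
    ((Ω.smooth e' he').contDiffAt (e'.open_target.mem_nhds hφt)).differentiableAt (by simp)
  have dβ : DifferentiableAt ℝ (pullbackForm Ω h e e') p := by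
    have d1 : DifferentiableAt ℝ (fun q => localForm Ω.form e' (φ q)) p :=
      dω.comp p (dφ.differentiableAt (by simp))
    have d2 : DifferentiableAt ℝ (fderiv ℝ φ) p :=
      (dφ.fderiv_right (m := 1) (by norm_cast)).differentiableAt (by simp)
    exact d1.continuousAlternatingMapCompContinuousLinearMap d2
  refine ⟨dβ, ?_⟩
  have closed : extDeriv (pullbackForm Ω h e e') p = 0 := by
    refine (extDeriv_pullback dω dφ two_le).trans ?_
    rw [Ω.closed e' he' _ hφt]
    ext; simp
  set K : ℝ × Model n → ℝ := fun q => H q.1 (h q.1 (e.symm q.2)) with hK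
  have dK : ContDiffAt ℝ ∞ K p := by
    refine contDiffAt_comp_chart_symm (F := fun q : ℝ × Y => H q.1 (h q.1 q.2)) he hp ?_
    exact (ContMDiff.comp (g := fun p : ℝ × Y => H p.1 p.2) (f := fun p : ℝ × Y => (p.1, h p.1 p.2))
      g.smooth_ham (contMDiff_fst.prodMk hh)).contMDiffAt
  have hev : ∀ᶠ q in 𝓝 p, q.2 ∈ e.target ∧ h q.1 (e.symm q.2) ∈ e'.source := by
    have c : ContinuousAt (fun q : ℝ × Model n => h q.1 (e.symm q.2)) p :=
      ContinuousAt.comp (g := fun q : ℝ × Y => h q.1 q.2)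
        (f := fun q : ℝ × Model n => (q.1, e.symm q.2)) (ContMDiff.continuous hh).continuousAt
        (continuousAt_fst.prodMk ((e.symm.continuousAt hp).comp continuousAt_snd))
    exact (continuousAt_snd.eventually (e.open_target.mem_nhds hp)).and
      (c.eventually (e'.open_source.mem_nhds hp'))
  -- the mixed terms of `dβ = 0` are second derivatives of the pulled back Hamiltonian `K`, which
  -- cancel by symmetry
  have hterm : ∀ c d : Model n,
      fderiv ℝ (fun q => pullbackForm Ω h e e' q ![(1, 0), (0, c)]) p (0, d) =
        -fderiv ℝ (fderiv ℝ K) p (0, d) (0, c) := by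
    intro c d
    have h1 : (fun q => pullbackForm Ω h e e' q ![(1, 0), (0, c)]) =ᶠ[𝓝 p]
        fun q => -fderiv ℝ K q (0, c) := by
      filter_upwards [hev] with q hq using g.pullbackForm_time he he' hq.1 hq.2 c
    have d2 : DifferentiableAt ℝ (fderiv ℝ K) p :=
      (dK.fderiv_right (m := 1) (by norm_cast)).differentiableAt (by simp)
    rw [h1.fderiv_eq, fderiv_fun_neg]
    have h3 := (d2.hasFDerivAt.clm_apply (hasFDerivAt_const ((0, c) : ℝ × Model n) p)).fderiv
    rw [h3]
    simp
  have symm : fderiv ℝ (fderiv ℝ K) p (0, a) (0, b) = fderiv ℝ (fderiv ℝ K) p (0, b) (0, a) :=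
    dK.isSymmSndFDerivAt two_le _ _
  have h0 := extDeriv_apply dβ ![(1, 0), (0, a), (0, b)]
  have r0 : (0 : Fin 3).removeNth ![((1 : ℝ), (0 : Model n)), (0, a), (0, b)] =
      ![(0, a), (0, b)] := by ext i : 1; fin_cases i <;> rfl
  have r1 : (1 : Fin 3).removeNth ![((1 : ℝ), (0 : Model n)), (0, a), (0, b)] =
      ![(1, 0), (0, b)] := by ext i : 1; fin_cases i <;> rfl
  have r2 : (2 : Fin 3).removeNth ![((1 : ℝ), (0 : Model n)), (0, a), (0, b)] =
      ![(1, 0), (0, a)] := by ext i : 1; fin_cases i <;> rfl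
  rw [closed, Fin.sum_univ_three, r0, r1, r2] at h0
  have t1 := hterm b a
  have t2 := hterm a b
  simp at h0
  linarith

/-- A Hamiltonian path starting at the identity consists of symplectic diffeomorphisms. -/
theorem Generates.isSymplectic [IsManifold (𝓡 (2 * n)) ∞ Y] (g : Generates Ω H h) (h0 : h 0 = 1)
    (t : ℝ) : IsSymplectic Ω (h t) := by
  intro y v w
  have hh : SmoothFamily h := g.smooth_path
  set e := chartAt (Model n) y
  have he : e ∈ charts n Y := chartAt_mem_charts y
  have hy : y ∈ e.source := mem_chart_source _ _
  have hey : e y ∈ e.target := e.map_source hy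
  set G : ℝ → ℝ := fun t => Ω.pair (h t y) (der (h t) y v) (der (h t) y w) with hG
  -- `h_t^* Ω` on fixed vectors is constant in `t`; the chart `e'` follows the moving point
  have hderiv : ∀ t, HasDerivAt G 0 t := by
    intro t
    set e' := chartAt (Model n) (h t y)
    have he' : e' ∈ charts n Y := chartAt_mem_charts _
    have hy' : h t y ∈ e'.source := mem_chart_source _ _
    have key := g.fderiv_pullbackForm_eq_zero he he' (p := (t, e y)) hey
      (by simpa [e.left_inv hy] using hy') (derChart e y v) (derChart e y w)
    have h1 : G =ᶠ[𝓝 t] fun s => pullbackForm Ω h e e' (s, e y)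
        ![(0, derChart e y v), (0, derChart e y w)] := by
      have c : ContinuousAt (fun s => h s y) t := (hh.mdiffAt_orbit t y).continuousAt
      filter_upwards [c.eventually (e'.open_source.mem_nhds hy')] with s hs
      have hs' : h s (e.symm (e y)) ∈ e'.source := by rw [e.left_inv hy]; exact hs
      rw [hh.pullbackForm_space he he' (p := (s, e y)) hey hs']
      simp only [derChartSymm_derChart he hy, e.left_inv hy, hG]
    refine HasDerivAt.congr_of_eventuallyEq ?_ h1
    have d : DifferentiableAt ℝ (fun q => pullbackForm Ω h e e' q
        ![(0, derChart e y v), (0, derChart e y w)]) (t, e y) :=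
      key.1.continuousAlternatingMap_apply_const _
    have h2 : HasFDerivAt (fun s : ℝ => (s, e y)) (.inl ℝ ℝ (Model n)) t :=
      hasFDerivAt_prodMk_left _ _
    have h3 := (d.hasFDerivAt.comp t h2).hasDerivAt
    simpa [key.2, Function.comp_def] using h3
  have hconst : G t = G 0 :=
    is_const_of_deriv_eq_zero (fun s => (hderiv s).differentiableAt) (fun s => (hderiv s).deriv) t 0
  refine hconst.trans ?_
  simp [hG, h0, der_one]

lemma IsSymplectic.inv {φ : Diffeo n Y} (hφ : IsSymplectic Ω φ) : IsSymplectic Ω φ⁻¹ :=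
  fun y v w => by
    have h := hφ (φ⁻¹ y) (der φ⁻¹ y v) (der φ⁻¹ y w)
    rw [der_der_inv, der_der_inv, Diffeo.apply_inv_apply] at h
    exact h.symm

/-! ### The calculus of Hamiltonian paths -/

lemma velocity_mul {f k : ℝ → Diffeo n Y} (hf : SmoothFamily f) (hk : SmoothFamily k) (t : ℝ)
    (y : Y) : velocity (fun s => f s * k s) t y =
      velocity f t (k t y) + der (f t) (k t y) (velocity k t y) := by
  have d : MDifferentiableAt (𝓘(ℝ, ℝ).prod (𝓡 (2 * n))) (𝓡 (2 * n))
      (fun p : ℝ × Y => f p.1 p.2) (t, k t y) :=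
    (ContMDiff.contMDiffAt hf).mdifferentiableAt (by simp)
  have h1 := mfderiv_comp (I := 𝓘(ℝ, ℝ)) t d (f := fun s : ℝ => (s, k s y))
    (mdifferentiableAt_id.prodMk (hk.mdiffAt_orbit t y))
  have h2 := mfderiv_prodMk (I := 𝓘(ℝ, ℝ)) (mdifferentiableAt_id (x := t)) (hk.mdiffAt_orbit t y)
  rw [mfderiv_id] at h2
  have h3 := congrArg (fun A : ℝ →L[ℝ] Model n => A 1) h1
  have h4 := mfderiv_prod_eq_add_apply (v := ((1 : ℝ), velocity k t y)) d
  refine h3.trans (Eq.trans ?_ h4)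
  exact congrArg (mfderiv (𝓘(ℝ, ℝ).prod (𝓡 (2 * n))) (𝓡 (2 * n))
    (fun p : ℝ × Y => f p.1 p.2) (t, k t y))
    (congrArg (fun A : ℝ →L[ℝ] ℝ × Model n => A 1) h2)

lemma velocity_const (φ : Diffeo n Y) (t : ℝ) (y : Y) : velocity (fun _ => φ) t y = 0 :=
  congrArg (fun A : ℝ →L[ℝ] Model n => A 1) mfderiv_const

/-- The velocity of the inverse path, from differentiating `f f⁻¹ = 1`. -/
lemma der_velocity_inv [IsManifold (𝓡 (2 * n)) ∞ Y] {f : ℝ → Diffeo n Y} (hf : SmoothFamily f)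
    (t : ℝ) (y : Y) : der (f t) ((f t)⁻¹ y) (velocity (fun s => (f s)⁻¹) t y) =
      -velocity f t ((f t)⁻¹ y) := by
  have h := velocity_mul hf hf.inv t y
  simp only [mul_inv_cancel, velocity_const] at h
  exact eq_neg_of_add_eq_zero_right h.symm

lemma differential_comp {F : Y → ℝ} {φ : Diffeo n Y} {y : Y}
    (hF : MDifferentiableAt (𝓡 (2 * n)) 𝓘(ℝ, ℝ) F (φ y)) (w : Model n) :
    differential (fun z => F (φ z)) y w = differential F (φ y) (der φ y w) :=
  congrArg (fun A : Model n →L[ℝ] ℝ => A w) (mfderiv_comp y hF (Diffeo.mdiffAt φ y))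

lemma differential_add {F K : Y → ℝ} {y : Y}
    (hF : MDifferentiableAt (𝓡 (2 * n)) 𝓘(ℝ, ℝ) F y)
    (hK : MDifferentiableAt (𝓡 (2 * n)) 𝓘(ℝ, ℝ) K y) (w : Model n) :
    differential (fun z => F z + K z) y w = differential F y w + differential K y w :=
  congrArg (fun A : Model n →L[ℝ] ℝ => A w) (mfderiv_add hF hK)

lemma differential_const_mul {F : Y → ℝ} {y : Y}
    (hF : MDifferentiableAt (𝓡 (2 * n)) 𝓘(ℝ, ℝ) F y) (c : ℝ) (w : Model n) :
    differential (fun z => c * F z) y w = c * differential F y w :=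
  congrArg (fun A : Model n →L[ℝ] ℝ => A w) (const_smul_mfderiv hF c)

lemma differential_neg (F : Y → ℝ) (y : Y) (w : Model n) :
    differential (fun z => -F z) y w = -differential F y w :=
  congrArg (fun A : Model n →L[ℝ] ℝ => A w) mfderiv_neg

lemma contMDiff_ham_comp (g : Generates Ω H h) {L : ℝ → Diffeo n Y} (hL : SmoothFamily L) :
    ContMDiff (𝓘(ℝ, ℝ).prod (𝓡 (2 * n))) 𝓘(ℝ, ℝ) ∞ fun p : ℝ × Y => H p.1 (L p.1 p.2) :=
  ContMDiff.comp (g := fun p : ℝ × Y => H p.1 p.2) (f := fun p : ℝ × Y => (p.1, L p.1 p.2))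
    g.smooth_ham (contMDiff_fst.prodMk hL)

variable {K : ℝ → Y → ℝ} {k : ℝ → Diffeo n Y}

/-- The product of two Hamiltonian paths: the field of `K` is carried over by the symplectic `h t`
to the field of `K ∘ (h t)⁻¹`. -/
lemma Generates.mul [IsManifold (𝓡 (2 * n)) ∞ Y] (g : Generates Ω H h) (g' : Generates Ω K k)
    (hs : ∀ t, IsSymplectic Ω (h t)) :
    Generates Ω (fun t y => H t y + K t ((h t)⁻¹ y)) fun t => h t * k t := by
  have hh : SmoothFamily h := g.smooth_path
  have hk : SmoothFamily k := g'.smooth_path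
  refine .of_pair (hh.mul hk) (g.smooth_ham.add (contMDiff_ham_comp g' hh.inv)) fun t y w => ?_
  have d : MDifferentiableAt (𝓡 (2 * n)) 𝓘(ℝ, ℝ) (fun z => K t ((h t)⁻¹ z)) (h t (k t y)) :=
    (g'.mdiffAt_ham t _).comp _ (Diffeo.mdiffAt (h t)⁻¹ _)
  rw [velocity_mul hh hk, Ω.pair_add_left, Diffeo.mul_apply,
    differential_add (g.mdiffAt_ham t _) d,
    differential_comp (g'.mdiffAt_ham t _), g.pair_velocity, Diffeo.inv_apply_apply]
  have h1 := hs t (k t y) (velocity k t y) (der (h t)⁻¹ (h t (k t y)) w)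
  have h2 := der_der_inv (h t) (h t (k t y)) w
  rw [Diffeo.inv_apply_apply] at h2
  rw [h2, g'.pair_velocity] at h1
  rw [h1]
  ring

lemma Generates.inv [IsManifold (𝓡 (2 * n)) ∞ Y] (g : Generates Ω H h)
    (hs : ∀ t, IsSymplectic Ω (h t)) :
    Generates Ω (fun t y => -H t (h t y)) fun t => (h t)⁻¹ := by
  have hh : SmoothFamily h := g.smooth_path
  refine .of_pair hh.inv (contMDiff_ham_comp g hh).neg fun t y w => ?_
  have h2 := g.pair_velocity t ((h t)⁻¹ y) (der (h t) ((h t)⁻¹ y) w)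
  rw [differential_neg, differential_comp (g.mdiffAt_ham t _),
    ← hs t ((h t)⁻¹ y), der_velocity_inv hh, Ω.pair_neg_left, h2]

lemma Generates.const (Ω : SymplecticForm n Y) (φ : Diffeo n Y) :
    Generates Ω (fun _ _ => 0) fun _ => φ := by
  refine .of_pair (SmoothFamily.const φ) contMDiff_const fun t y w => ?_
  rw [velocity_const, Ω.pair_zero_left]
  have : differential (fun _ : Y => (0 : ℝ)) (φ y) w = 0 :=
    congrArg (fun A : Model n →L[ℝ] ℝ => A w) mfderiv_const
  rw [this, neg_zero]

lemma velocity_comp (hh : SmoothFamily h) {σ : ℝ → ℝ} {t : ℝ} (hσ : DifferentiableAt ℝ σ t)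
    (y : Y) : velocity (fun s => h (σ s)) t y = deriv σ t • velocity h (σ t) y := by
  have h1 := mfderiv_comp (I := 𝓘(ℝ, ℝ)) (I' := 𝓘(ℝ, ℝ)) t (hh.mdiffAt_orbit (σ t) y)
    hσ.mdifferentiableAt
  rw [mfderiv_eq_fderiv] at h1
  have h2 := congrArg (fun A : ℝ →L[ℝ] Model n => A 1) h1
  have h3 : fderiv ℝ σ t 1 = deriv σ t • (1 : ℝ) := by simp
  exact (h2.trans (congrArg (show ℝ →L[ℝ] Model n from
    mfderiv 𝓘(ℝ, ℝ) (𝓡 (2 * n)) (fun s : ℝ => h s y) (σ t)) h3)).trans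
    (ContinuousLinearMap.map_smul (show ℝ →L[ℝ] Model n from
      mfderiv 𝓘(ℝ, ℝ) (𝓡 (2 * n)) (fun s : ℝ => h s y) (σ t)) _ _)

lemma Generates.reparam (g : Generates Ω H h) {σ : ℝ → ℝ} (hσ : ContDiff ℝ ∞ σ) :
    Generates Ω (fun t y => deriv σ t * H (σ t) y) fun t => h (σ t) := by
  have hh : SmoothFamily h := g.smooth_path
  refine .of_pair (hh.comp hσ) ?_ fun t y w => ?_
  · have hd : ContDiff ℝ ∞ (deriv σ) := (contDiff_infty_iff_deriv.1 hσ).2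
    exact (hd.contMDiff.comp contMDiff_fst).mul (ContMDiff.comp (g := fun p : ℝ × Y => H p.1 p.2)
      (f := fun p : ℝ × Y => (σ p.1, p.2)) g.smooth_ham
      ((hσ.contMDiff.comp contMDiff_fst).prodMk contMDiff_snd))
  · rw [velocity_comp hh (hσ.differentiable (by simp) t), Ω.pair_smul_left, g.pair_velocity,
      differential_const_mul (g.mdiffAt_ham _ _), mul_neg]

lemma Generates.congr (g : Generates Ω H h) (hH : ∀ t y, H t y = K t y) (hk : ∀ t, h t = k t) :
    Generates Ω K k := by
  obtain rfl : H = K := funext fun t => funext (hH t)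
  obtain rfl : h = k := funext hk
  exact g

/-- The property defining Hamiltonian diffeomorphisms. -/
def IsHam (Ω : SymplecticForm n Y) (φ : Diffeo n Y) : Prop :=
  ∃ (H : ℝ → Y → ℝ) (h : ℝ → Diffeo n Y), Generates Ω H h ∧ h 0 = 1 ∧ h 1 = φ

/-- All members of a Hamiltonian path from the identity are Hamiltonian: run the path up to time `t`
in unit time. -/
lemma Generates.isHam (g : Generates Ω H h) (h0 : h 0 = 1) (t : ℝ) : IsHam Ω (h t) :=
  ⟨_, _, g.reparam (σ := fun s => s * t) (contDiff_id.mul contDiff_const), by simpa using h0,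
    by simp⟩

variable [IsManifold (𝓡 (2 * n)) ∞ Y]

lemma IsHam.isSymplectic {φ : Diffeo n Y} (hφ : IsHam Ω φ) : IsSymplectic Ω φ := by
  obtain ⟨H, h, g, h0, rfl⟩ := hφ
  exact g.isSymplectic h0 1

lemma IsHam.mul {φ ψ : Diffeo n Y} (hφ : IsHam Ω φ) (hψ : IsHam Ω ψ) : IsHam Ω (φ * ψ) := by
  obtain ⟨H, h, g, h0, rfl⟩ := hφ
  obtain ⟨K, k, g', k0, rfl⟩ := hψ
  exact ⟨_, _, g.mul g' (g.isSymplectic h0), by simp [h0, k0], rfl⟩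

lemma IsHam.inv {φ : Diffeo n Y} (hφ : IsHam Ω φ) : IsHam Ω φ⁻¹ := by
  obtain ⟨H, h, g, h0, rfl⟩ := hφ
  exact ⟨_, _, g.inv (g.isSymplectic h0), by simp [h0], rfl⟩

end Symplectic

/-! ### Flows of compactly supported vector fields -/

section Flow

universe u

section Nemytskii

variable {I E F : Type*} [TopologicalSpace I] [CompactSpace I]
  [NormedAddCommGroup E] [NormedSpace ℝ E] [NormedAddCommGroup F] [NormedSpace ℝ F]

/-- The pointwise action of a continuous field of linear maps on a continuous function. -/
def pointwiseApply (I E F : Type*) [TopologicalSpace I] [CompactSpace I]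
    [NormedAddCommGroup E] [NormedSpace ℝ E] [NormedAddCommGroup F] [NormedSpace ℝ F] :
    C(I, E →L[ℝ] F) →L[ℝ] C(I, E) →L[ℝ] C(I, F) :=
  LinearMap.mkContinuous₂
    (LinearMap.mk₂ ℝ (fun (A : C(I, E →L[ℝ] F)) (η : C(I, E)) =>
        (⟨fun s => A s (η s), A.continuous.clm_apply η.continuous⟩ : C(I, F)))
      (fun A B η => by ext s; simp) (fun c A η => by ext s; simp)
      (fun A η ζ => by ext s; simp) (fun c A η => by ext s; simp)) 1
    (fun A η => by
      rw [one_mul]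
      refine (ContinuousMap.norm_le _ (by positivity)).2 fun s => ?_
      exact (A s).le_of_opNorm_le_of_le (A.norm_coe_le_norm s) (η.norm_coe_le_norm s))

/-- Composition with a `C¹` map with uniformly continuous derivative is differentiable for the
uniform norm. -/
lemma hasFDerivAt_continuousMap_comp (X : C(E, F)) (X' : C(E, E →L[ℝ] F))
    (hX : ∀ x, HasFDerivAt X (X' x) x) (hu : UniformContinuous X') (γ : C(I, E)) :
    HasFDerivAt (fun η : C(I, E) => X.comp η) (pointwiseApply I E F (X'.comp γ)) γ := by
  rw [hasFDerivAt_iff_isLittleO, Asymptotics.isLittleO_iff]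
  intro c hc
  obtain ⟨δ, hδ, hδ'⟩ := Metric.uniformContinuous_iff.1 hu c hc
  filter_upwards [Metric.ball_mem_nhds γ hδ] with η hη
  refine (ContinuousMap.norm_le _ (by positivity)).2 fun s => ?_
  have hs : dist (η s) (γ s) < δ := (ContinuousMap.dist_apply_le_dist s).trans_lt hη
  have h := Convex.norm_image_sub_le_of_norm_hasFDerivWithin_le' (𝕜 := ℝ) (f := X) (f' := X')
    (φ := X' (γ s)) (C := c) (s := Metric.ball (γ s) δ) (x := γ s) (y := η s)
    (fun x _ => (hX x).hasFDerivWithinAt)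
    (fun x hx => by rw [← dist_eq_norm]; exact (hδ' hx).le)
    (convex_ball _ _) (Metric.mem_ball_self hδ) hs
  refine h.trans ?_
  gcongr
  exact (η - γ).norm_coe_le_norm s

/-- Induction on the order of differentiability: the derivative of composition with `X` is
composition with the derivative of `X`. -/
lemma contDiff_nat_continuousMap_comp {I : Type*} [TopologicalSpace I] [CompactSpace I]
    {E : Type u} [NormedAddCommGroup E] [NormedSpace ℝ E] (k : ℕ) :
    ∀ {F : Type u} [NormedAddCommGroup F] [NormedSpace ℝ F] (X : C(E, F)), ContDiff ℝ ∞ X →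
      HasCompactSupport X → ContDiff ℝ k fun η : C(I, E) => X.comp η := by
  induction k with
  | zero =>
    intro F _ _ X hX hs
    exact contDiff_zero.2 (ContinuousMap.continuous_postcomp X)
  | succ k ih =>
    intro F _ _ X hX hs
    let X' : C(E, E →L[ℝ] F) := ⟨fderiv ℝ X, hX.continuous_fderiv (by simp)⟩
    have hs' : HasCompactSupport X' := hs.fderiv ℝ
    have hX' : ContDiff ℝ ∞ X' := hX.fderiv_right (by simp)
    refine contDiff_succ_iff_hasFDerivAt.2 ⟨_, ?_, hasFDerivAt_continuousMap_comp X X'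
      (fun x => (hX.differentiable (by simp) x).hasFDerivAt)
      (hs'.uniformContinuous_of_continuous X'.continuous)⟩
    exact (pointwiseApply I E F).contDiff.comp (ih X' hX' hs')

/-- Composition with a compactly supported smooth map is smooth for the uniform norm. -/
lemma contDiff_continuousMap_comp {I : Type*} [TopologicalSpace I] [CompactSpace I] {E F : Type u}
    [NormedAddCommGroup E] [NormedSpace ℝ E] [NormedAddCommGroup F] [NormedSpace ℝ F] (X : C(E, F))
    (hX : ContDiff ℝ ∞ X) (hs : HasCompactSupport X) :
    ContDiff ℝ ∞ fun η : C(I, E) => X.comp η :=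
  contDiff_infty.2 fun k => contDiff_nat_continuousMap_comp k X hX hs

end Nemytskii

/-- The time interval on which the integral equation of a flow is solved. -/
abbrev TimeInterval : Type := Set.Icc (-1 : ℝ) 1

variable {E : Type*} [NormedAddCommGroup E]

/-- The continuous extension of a curve to the real line, constant outside of the interval. -/
def extend (γ : C(TimeInterval, E)) : ℝ → E := Set.IccExtend (by norm_num) γ

lemma continuous_extend (γ : C(TimeInterval, E)) : Continuous (extend γ) :=
  γ.continuous.Icc_extend'

lemma extend_of_mem (γ : C(TimeInterval, E)) {s : ℝ} (hs : s ∈ Set.Icc (-1 : ℝ) 1) :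
    extend γ s = γ ⟨s, hs⟩ := Set.IccExtend_of_mem _ _ hs

lemma intervalIntegrable_extend (γ : C(TimeInterval, E)) (a b : ℝ) :
    IntervalIntegrable (extend γ) volume a b := (continuous_extend γ).intervalIntegrable a b

variable [NormedSpace ℝ E]

/-- Uniqueness of trajectories, for points where the vector field vanishes. -/
lemma flow_eq_self {X : E → E} {K : NNReal} (hK : LipschitzWith K X) {T : ℝ} {Φ : ℝ × E → E}
    (h0 : ∀ x, Φ (0, x) = x)
    (hΦ : ∀ t x, |t| < T → HasDerivAt (fun s => Φ (s, x)) (X (Φ (t, x))) t) {x : E} (hx : X x = 0)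
    {t : ℝ} (ht : |t| < T) : Φ (t, x) = x := by
  have h := ODE_solution_unique_of_mem_Ioo (v := fun _ => X) (s := fun _ => Set.univ) (K := K)
    (f := fun s => Φ (s, x)) (g := fun _ => x) (a := -T) (b := T) (t₀ := 0)
    (fun _ _ => hK.lipschitzOnWith) (abs_lt.1 (by simpa using (abs_nonneg t).trans_lt ht))
    (fun s hs => ⟨hΦ s x (abs_lt.2 hs), trivial⟩)
    (fun s _ => ⟨by simpa [hx] using hasDerivAt_const s x, trivial⟩) (h0 x)
  exact h (abs_lt.1 ht)

/-- The flow property for opposite times, by uniqueness of trajectories. -/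
lemma flow_neg_flow {X : E → E} {K : NNReal} (hK : LipschitzWith K X) {T : ℝ} {Φ : ℝ × E → E}
    (h0 : ∀ x, Φ (0, x) = x)
    (hΦ : ∀ t x, |t| < T → HasDerivAt (fun s => Φ (s, x)) (X (Φ (t, x))) t) (x : E)
    {t : ℝ} (ht : |t| < T) : Φ (-t, Φ (t, x)) = x := by
  obtain ⟨ht1, ht2⟩ := abs_lt.1 ht
  have hm : ∀ s ∈ Set.Ioo (max (-T) (-T - t)) (min T (T - t)), |s| < T ∧ |s + t| < T := by
    rintro s ⟨hs1, hs2⟩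
    obtain ⟨h1, h2⟩ := max_lt_iff.1 hs1
    obtain ⟨h3, h4⟩ := lt_min_iff.1 hs2
    exact ⟨abs_lt.2 ⟨h1, h3⟩, abs_lt.2 ⟨by linarith, by linarith⟩⟩
  have h := ODE_solution_unique_of_mem_Ioo (v := fun _ => X) (s := fun _ => Set.univ) (K := K)
    (f := fun s => Φ (s, Φ (t, x))) (g := fun s => Φ (s + t, x)) (t₀ := 0)
    (fun _ _ => hK.lipschitzOnWith)
    (a := max (-T) (-T - t)) (b := min T (T - t))
    ⟨max_lt (by linarith) (by linarith), lt_min (by linarith) (by linarith)⟩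
    (fun s hs => ⟨hΦ s _ (hm s hs).1, trivial⟩)
    (fun s hs => ⟨(hΦ (s + t) x (hm s hs).2).comp_add_const s t, trivial⟩) (by simp [h0])
  have h2 := h (x := -t) ⟨max_lt (by linarith) (by linarith), lt_min (by linarith) (by linarith)⟩
  simpa [h0] using h2

variable [CompleteSpace E]

/-- The primitive vanishing at `0`, as an operator on continuous curves. -/
def primitive (E : Type*) [NormedAddCommGroup E] [NormedSpace ℝ E] [CompleteSpace E] :
    C(TimeInterval, E) →L[ℝ] C(TimeInterval, E) :=
  LinearMap.mkContinuous
    { toFun := fun γ => ⟨fun s => ∫ τ in (0 : ℝ)..s, extend γ τ,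
        (intervalIntegral.continuous_primitive
          (fun a b => intervalIntegrable_extend γ a b) 0).comp continuous_subtype_val⟩
      map_add' := fun γ η => by
        ext s
        exact intervalIntegral.integral_add (intervalIntegrable_extend γ _ _)
          (intervalIntegrable_extend η _ _)
      map_smul' := fun c γ => by
        ext s
        exact intervalIntegral.integral_smul c (extend γ) } 1
    (fun γ => by
      refine (ContinuousMap.norm_le _ (by positivity)).2 fun s => ?_
      have h := intervalIntegral.norm_integral_le_of_norm_le_const (a := 0) (b := (s : ℝ))
        (f := extend γ) (C := ‖γ‖) (fun x _ => γ.norm_coe_le_norm _)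
      refine h.trans ?_
      rw [one_mul, sub_zero]
      exact mul_le_of_le_one_right (norm_nonneg _) (abs_le.2 s.2))

lemma norm_primitive_le : ‖primitive E‖ ≤ 1 := LinearMap.mkContinuous_norm_le _ zero_le_one _

/-- The integral operator `γ ↦ x + t ∫₀ˢ X(γ)`, whose fixed point is the rescaled integral curve
`s ↦ Φ(ts, x)` of the vector field `X`. -/
def picardMap (X : C(E, E)) (p : ℝ × E) (γ : C(TimeInterval, E)) : C(TimeInterval, E) :=
  ContinuousMap.const _ p.2 + p.1 • primitive E (X.comp γ)

lemma contractingWith_picardMap {X : C(E, E)} {K : NNReal} (hX : LipschitzWith K X) {p : ℝ × E}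
    (hp : |p.1| * K ≤ 1 / 2) : ContractingWith (1 / 2) (picardMap X p) := by
  refine ⟨by norm_num, LipschitzWith.of_dist_le_mul fun γ η => ?_⟩
  have h1 : dist (X.comp γ) (X.comp η) ≤ K * dist γ η :=
    (ContinuousMap.dist_le (by positivity)).2 fun s => (hX.dist_le_mul _ _).trans
      (mul_le_mul_of_nonneg_left (ContinuousMap.dist_apply_le_dist s) K.2)
  rw [picardMap, picardMap, dist_add_left, dist_eq_norm, ← smul_sub, norm_smul,
    ← map_sub]
  calc ‖p.1‖ * ‖primitive E (X.comp γ - X.comp η)‖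
      ≤ |p.1| * (1 * ‖X.comp γ - X.comp η‖) := by
        gcongr
        · exact le_rfl
        · exact (primitive E).le_of_opNorm_le norm_primitive_le _
    _ ≤ |p.1| * (K * dist γ η) := by
        rw [one_mul, ← dist_eq_norm]; gcongr
    _ = (|p.1| * K) * dist γ η := by ring
    _ ≤ _ := by
        gcongr
        simpa using hp

/-- The rescaled integral curve `s ↦ Φ(ts, x)`, `p = (t, x)`: a fixed point of `picardMap X p`,
which is unique for small `t`, and `0` if there is none. -/
def integralCurve (X : C(E, E)) (p : ℝ × E) : C(TimeInterval, E) :=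
  open Classical in
  if h : ∃ γ, Function.IsFixedPt (picardMap X p) γ then h.choose else 0

lemma isFixedPt_integralCurve {X : C(E, E)} {K : NNReal} (hX : LipschitzWith K X) {p : ℝ × E}
    (hp : |p.1| * K ≤ 1 / 2) :
    Function.IsFixedPt (picardMap X p) (integralCurve X p) := by
  have h : ∃ γ, Function.IsFixedPt (picardMap X p) γ :=
    ⟨_, (contractingWith_picardMap hX hp).fixedPoint_isFixedPt⟩
  rw [integralCurve, dif_pos h]
  exact h.choose_spec

lemma eq_integralCurve {X : C(E, E)} {K : NNReal} (hX : LipschitzWith K X) {p : ℝ × E}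
    (hp : |p.1| * K ≤ 1 / 2) {γ : C(TimeInterval, E)}
    (hγ : Function.IsFixedPt (picardMap X p) γ) : γ = integralCurve X p :=
  ((contractingWith_picardMap hX hp).fixedPoint_unique hγ).trans
    ((contractingWith_picardMap hX hp).fixedPoint_unique (isFixedPt_integralCurve hX hp)).symm

lemma integralCurve_apply {X : C(E, E)} {K : NNReal} (hX : LipschitzWith K X) {p : ℝ × E}
    (hp : |p.1| * K ≤ 1 / 2) (s : TimeInterval) :
    integralCurve X p s =
      p.2 + p.1 • ∫ τ in (0 : ℝ)..s, X (extend (integralCurve X p) τ) :=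
  (congrArg (fun γ : C(TimeInterval, E) => γ s) (isFixedPt_integralCurve hX hp)).symm

/-- The derivative of `γ ↦ γ - picardMap X p γ` is invertible, by the Neumann series. -/
lemma isInvertible_one_sub_primitive {X' : C(E, E →L[ℝ] E)} {K : NNReal}
    (hX' : ∀ x, ‖X' x‖ ≤ K) {t : ℝ} (ht : |t| * K ≤ 1 / 2) (γ : C(TimeInterval, E)) :
    (ContinuousLinearMap.id ℝ C(TimeInterval, E) -
      t • (primitive E ∘L pointwiseApply TimeInterval E E (X'.comp γ))).IsInvertible := by
  set A := t • (primitive E ∘L pointwiseApply TimeInterval E E (X'.comp γ)) with hA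
  have hn : ‖A‖ ≤ 1 / 2 := by
    refine ContinuousLinearMap.opNorm_le_bound _ (by norm_num) fun η => ?_
    have h1 : ‖pointwiseApply TimeInterval E E (X'.comp γ) η‖ ≤ K * ‖η‖ :=
      (ContinuousMap.norm_le _ (by positivity)).2 fun s =>
        (X' (γ s)).le_of_opNorm_le_of_le (hX' _) (η.norm_coe_le_norm s)
    calc ‖A η‖ = |t| * ‖primitive E (pointwiseApply TimeInterval E E (X'.comp γ) η)‖ :=
          norm_smul t (primitive E (pointwiseApply TimeInterval E E (X'.comp γ) η))
      _ ≤ |t| * (1 * (K * ‖η‖)) := by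
          gcongr
          exact (primitive E).le_of_opNorm_le_of_le norm_primitive_le h1
      _ = (|t| * K) * ‖η‖ := by ring
      _ ≤ 1 / 2 * ‖η‖ := by gcongr
  obtain ⟨U, hU⟩ := isUnit_one_sub_of_norm_lt_one
    (R := C(TimeInterval, E) →L[ℝ] C(TimeInterval, E)) (x := A)
    (hn.trans_lt (by norm_num : (1 / 2 : ℝ) < 1))
  exact ⟨ContinuousLinearEquiv.unitsEquiv ℝ _ U, by ext η : 1; simp [hU]⟩

/-- Smooth dependence on time and initial condition, from the implicit function theorem in the
space of continuous curves. -/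
lemma contDiffAt_integralCurve {X : C(E, E)} (hX : ContDiff ℝ ∞ X) (hs : HasCompactSupport X)
    {K : NNReal} (hK : LipschitzWith K X) {p : ℝ × E} (hp : |p.1| * K < 1 / 2) :
    ContDiffAt ℝ ∞ (integralCurve X) p := by
  set f : (ℝ × E) × C(TimeInterval, E) → C(TimeInterval, E) :=
    fun q => q.2 - picardMap X q.1 q.2 with hf
  have df : ContDiff ℝ ∞ f := by
    have h1 : ContDiff ℝ ∞ fun q : (ℝ × E) × C(TimeInterval, E) =>
        ContinuousLinearMap.const ℝ TimeInterval (M := E) q.1.2 := by fun_prop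
    have h2 : ContDiff ℝ ∞ fun q : (ℝ × E) × C(TimeInterval, E) =>
        q.1.1 • primitive E (X.comp q.2) :=
      (contDiff_fst.comp contDiff_fst).smul ((primitive E).contDiff.comp
        ((contDiff_continuousMap_comp X hX hs).comp contDiff_snd))
    exact contDiff_snd.sub (h1.add h2)
  set u : (ℝ × E) × C(TimeInterval, E) := (p, integralCurve X p) with hu
  have hfu : f u = 0 := sub_eq_zero.2 (isFixedPt_integralCurve hK hp.le).symm
  obtain ⟨X', hX'⟩ : ∃ X' : C(E, E →L[ℝ] E), ⇑X' = fderiv ℝ X :=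
    ⟨⟨fderiv ℝ X, hX.continuous_fderiv (by simp)⟩, rfl⟩
  have hX'u : UniformContinuous X' := by
    refine HasCompactSupport.uniformContinuous_of_continuous ?_ X'.continuous
    rw [hX']
    exact hs.fderiv ℝ
  have hX'd : ∀ x, HasFDerivAt X (X' x) x := fun x => by
    rw [hX']
    exact (hX.differentiable (by simp) x).hasFDerivAt
  have hX'b : ∀ x, ‖X' x‖ ≤ K := fun x => by
    rw [hX']
    exact norm_fderiv_le_of_lipschitz ℝ hK
  have hinv : (fderiv ℝ f u ∘L .inr ℝ (ℝ × E) C(TimeInterval, E)).IsInvertible := by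
    have h1 : HasFDerivAt (fun γ => f (p, γ)) (fderiv ℝ f u ∘L .inr ℝ (ℝ × E) C(TimeInterval, E))
        u.2 :=
      HasFDerivAt.comp (g := f) u.2 (df.differentiable (by simp) u).hasFDerivAt
        (hasFDerivAt_prodMk_right _ _)
    have h2 := hasFDerivAt_continuousMap_comp X X' hX'd hX'u u.2
    have h3 : HasFDerivAt (fun γ => f (p, γ)) (ContinuousLinearMap.id ℝ C(TimeInterval, E) -
        p.1 • (primitive E ∘L pointwiseApply TimeInterval E E (X'.comp u.2))) u.2 := by
      have h4 : HasFDerivAt (picardMap X p)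
          (p.1 • (primitive E ∘L pointwiseApply TimeInterval E E (X'.comp u.2))) u.2 :=
        (((primitive E).hasFDerivAt.comp u.2 h2).const_smul p.1).const_add
          (ContinuousMap.const TimeInterval p.2)
      exact (hasFDerivAt_id u.2).sub h4
    rw [h1.unique h3]
    exact isInvertible_one_sub_primitive hX'b hp.le u.2
  have cf : ContDiffAt ℝ ∞ f u := df.contDiffAt
  have dψ := cf.contDiffAt_implicitFunction (by simp) hinv
  refine dψ.congr_of_eventuallyEq ?_
  have hp' : ∀ᶠ q : ℝ × E in 𝓝 p, |q.1| * K < 1 / 2 :=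
    (by fun_prop : Continuous fun q : ℝ × E => |q.1| * K).continuousAt.eventually_lt
      continuousAt_const hp
  filter_upwards [cf.eventually_apply_implicitFunction (by simp) hinv, hp'] with q hq hq'
  rw [hfu] at hq
  exact (eq_integralCurve hK hq'.le (sub_eq_zero.1 hq).symm).symm

/-- The flow is a rescaled restriction of a single integral curve. -/
lemma integralCurve_rescale {X : C(E, E)} {K : NNReal} (hK : LipschitzWith K X) {T r : ℝ}
    (hT : 0 < T) (hTK : T * K ≤ 1 / 2) (hr : |r| ≤ T) (x : E) :
    integralCurve X (r, x) ⟨1, by norm_num⟩ = extend (integralCurve X (T, x)) (r / T) := by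
  have hc : |r / T| ≤ 1 := by
    rw [abs_div, abs_of_pos hT]
    exact div_le_one_of_le₀ hr hT.le
  have hmem : ∀ s : ℝ, |s| ≤ 1 → r / T * s ∈ Set.Icc (-1 : ℝ) 1 := fun s hs => by
    rw [Set.mem_Icc, ← abs_le, abs_mul]
    exact mul_le_one₀ hc (abs_nonneg _) hs
  set γ := integralCurve X (T, x) with hγ
  have hγ' : ∀ s : ℝ, s ∈ Set.Icc (-1 : ℝ) 1 →
      extend γ s = x + T • ∫ τ in (0 : ℝ)..s, X (extend γ τ) := fun s hs => by
    rw [extend_of_mem γ hs, hγ]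
    exact integralCurve_apply hK (p := (T, x)) (by rwa [abs_of_pos hT]) ⟨s, hs⟩
  let η : C(TimeInterval, E) := ⟨fun s => extend γ (r / T * s),
    (continuous_extend γ).comp (continuous_const.mul continuous_subtype_val)⟩
  have hη : Function.IsFixedPt (picardMap X (r, x)) η := by
    ext s
    have hs : |(s : ℝ)| ≤ 1 := abs_le.2 s.2
    change x + r • ∫ τ in (0 : ℝ)..s, extend (X.comp η) τ = extend γ (r / T * s)
    rw [hγ' _ (hmem s hs)]
    have h1 : ∫ τ in (0 : ℝ)..s, extend (X.comp η) τ =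
        ∫ τ in (0 : ℝ)..s, X (extend γ (r / T * τ)) := by
      refine intervalIntegral.integral_congr fun τ hτ => ?_
      have hτ' : τ ∈ Set.Icc (-1 : ℝ) 1 :=
        (Set.uIcc_subset_Icc (by norm_num) s.2) hτ
      exact extend_of_mem _ hτ'
    have h2 := intervalIntegral.smul_integral_comp_mul_left (a := 0) (b := (s : ℝ))
      (fun τ => X (extend γ τ)) (r / T)
    rw [mul_zero] at h2
    rw [h1, ← h2, smul_smul, mul_div_cancel₀ _ hT.ne']
  have h := eq_integralCurve hK (p := (r, x))
    ((mul_le_mul_of_nonneg_right hr K.2).trans hTK) hη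
  rw [← h]
  change extend γ (r / T * 1) = _
  rw [mul_one]

/-- A compactly supported smooth vector field has a local flow `Φ` defined on a uniform time
interval and smooth jointly in time and space. -/
theorem exists_flow {X : E → E} (hX : ContDiff ℝ ∞ X) (hs : HasCompactSupport X) :
    ∃ (T : ℝ) (Φ : ℝ × E → E), 0 < T ∧ (∀ p : ℝ × E, |p.1| < T → ContDiffAt ℝ ∞ Φ p) ∧
      (∀ x, Φ (0, x) = x) ∧
      ∀ t x, |t| < T → HasDerivAt (fun s => Φ (s, x)) (X (Φ (t, x))) t := by
  let Xc : C(E, E) := ⟨X, hX.continuous⟩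
  obtain ⟨K, hK⟩ := hX.lipschitzWith_of_hasCompactSupport hs (by simp)
  have hK' : LipschitzWith K Xc := hK
  have hKp : (0 : ℝ) < 2 * (K + 1) := by positivity
  -- `picardMap` is a contraction for `|t| K ≤ 1 / 2`; `K + 1` allows for `K = 0`
  set T : ℝ := 1 / (2 * (K + 1)) with hT
  have hT0 : 0 < T := by positivity
  have hTK : T * K ≤ 1 / 2 := by
    rw [hT, div_mul_eq_mul_div, one_mul, div_le_div_iff₀ hKp two_pos]
    linarith
  have hTK' : ∀ t : ℝ, |t| < T → |t| * K < 1 / 2 := fun t ht => by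
    rcases K.2.eq_or_lt with h0 | h0
    · have : (K : ℝ) = 0 := h0.symm
      rw [this]; norm_num
    · exact (mul_lt_mul_of_pos_right ht h0).trans_le hTK
  refine ⟨T, fun p => integralCurve Xc p ⟨1, by norm_num⟩, hT0, fun p hp => ?_, fun x => ?_,
    fun t x ht => ?_⟩
  · exact (ContinuousMap.evalCLM ℝ (⟨1, by norm_num⟩ : TimeInterval)).contDiff.contDiffAt.comp p
      (contDiffAt_integralCurve (X := Xc) hX hs hK' (hTK' _ hp))
  · change integralCurve Xc (0, x) ⟨1, by norm_num⟩ = x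
    rw [integralCurve_apply hK' (by simp)]
    simp
  · have hev : (fun s => integralCurve Xc (s, x) ⟨1, by norm_num⟩) =ᶠ[𝓝 t]
        fun s => x + T • ∫ τ in (0 : ℝ)..(s / T), X (extend (integralCurve Xc (T, x)) τ) := by
      have ho : ∀ᶠ s : ℝ in 𝓝 t, |s| < T :=
        continuous_abs.continuousAt.eventually_lt continuousAt_const ht
      filter_upwards [ho] with s hs
      have hm : s / T ∈ Set.Icc (-1 : ℝ) 1 := by
        rw [Set.mem_Icc, ← abs_le, abs_div, abs_of_pos hT0]
        exact div_le_one_of_le₀ hs.le hT0.le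
      rw [integralCurve_rescale hK' hT0 hTK hs.le, extend_of_mem _ hm]
      exact integralCurve_apply hK' (p := (T, x)) (by rwa [abs_of_pos hT0]) ⟨_, hm⟩
    refine HasDerivAt.congr_of_eventuallyEq ?_ hev
    have hcont : Continuous fun τ => X (extend (integralCurve Xc (T, x)) τ) :=
      hX.continuous.comp (continuous_extend _)
    have h1 := hcont.integral_hasStrictDerivAt 0 (t / T)
    have h2 := h1.hasDerivAt.scomp t ((hasDerivAt_id t).div_const T)
    have h3 : HasDerivAt
        (fun s => x + T • ∫ τ in (0 : ℝ)..(s / T), X (extend (integralCurve Xc (T, x)) τ))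
        (T • (1 / T) • X (extend (integralCurve Xc (T, x)) (t / T))) t :=
      (h2.const_smul T).const_add x
    convert h3 using 1
    rw [smul_smul, mul_one_div_cancel hT0.ne', one_smul]
    exact congrArg X (integralCurve_rescale hK' hT0 hTK ht.le x)

end Flow

/-! ### Hamiltonian diffeomorphisms supported in a chart -/

section Push

/-- An alternating 2-form as a bilinear map, `(v, w) ↦ A ![v, w]`, depending linearly on the form.
-/
def curryTwo (E : Type*) [NormedAddCommGroup E] [NormedSpace ℝ E] :
    (E [⋀^Fin 2]→L[ℝ] ℝ) →L[ℝ] E →L[ℝ] E →L[ℝ] ℝ :=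
  have bound : ∀ (A : E [⋀^Fin 2]→L[ℝ] ℝ) (v w : E), ‖A ![v, w]‖ ≤ ‖A‖ * ‖v‖ * ‖w‖ :=
    fun A v w => by simpa [Fin.prod_univ_two, mul_assoc] using A.le_opNorm ![v, w]
  have upd : ∀ v w : E, Function.update ![v, 0] 1 w = ![v, w] := fun v w => by
    ext i : 1; fin_cases i <;> simp
  have add_right : ∀ (A : E [⋀^Fin 2]→L[ℝ] ℝ) (v w w' : E),
      A ![v, w + w'] = A ![v, w] + A ![v, w'] := fun A v w w' => by
    have h := A.map_update_add ![v, 0] 1 w w'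
    rwa [upd, upd, upd] at h
  have smul_right : ∀ (A : E [⋀^Fin 2]→L[ℝ] ℝ) (c : ℝ) (v w : E),
      A ![v, c • w] = c • A ![v, w] := fun A c v w => by
    have h := A.map_update_smul ![v, 0] 1 c w
    rwa [upd, upd] at h
  LinearMap.mkContinuous
    { toFun := fun A => LinearMap.mkContinuous₂
        (LinearMap.mk₂ ℝ (fun v w => A ![v, w]) (fun v v' w => A.vecCons_add ![w] v v')
          (fun c v w => A.vecCons_smul ![w] c v) (add_right A) (smul_right A)) ‖A‖ (bound A)
      map_add' := fun A B => rfl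
      map_smul' := fun c A => rfl } 1
    (fun A => by
      rw [one_mul]
      exact LinearMap.mkContinuous₂_norm_le _ (norm_nonneg A) (bound A))

@[simp] lemma curryTwo_apply {E : Type*} [NormedAddCommGroup E] [NormedSpace ℝ E]
    (A : E [⋀^Fin 2]→L[ℝ] ℝ) (v w : E) : curryTwo E A v w = A ![v, w] := rfl

variable {Ω : SymplecticForm n Y} {e : OpenPartialHomeomorph Y (Model n)}

lemma SymplecticForm.eq_zero_of_pair {Ω : SymplecticForm n Y} {y : Y} {v : Model n}
    (h : ∀ w, Ω.pair y v w = 0) : v = 0 := Ω.nondegenerate y v h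

lemma isInvertible_curryTwo_localForm (he : e ∈ charts n Y) {u : Model n} (hu : u ∈ e.target) :
    (curryTwo (Model n) (localForm Ω.form e u)).IsInvertible := by
  set B := curryTwo (Model n) (localForm Ω.form e u) with hB
  have hinj : Function.Injective (B : Model n →ₗ[ℝ] (Model n →L[ℝ] ℝ)) := by
    rw [← LinearMap.ker_eq_bot, LinearMap.ker_eq_bot']
    intro v hv
    have h1 : derChartSymm e u v = 0 := by
      refine Ω.eq_zero_of_pair (y := e.symm u) fun w => ?_
      have h2 := congrArg (fun A : Model n →L[ℝ] ℝ => A (derChart e (e.symm u) w)) hv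
      have h3 : localForm Ω.form e u ![v, derChart e (e.symm u) w] = 0 := h2
      rw [localForm_apply] at h3
      have h4 := derChartSymm_derChart he (e.map_target hu) w
      rw [e.right_inv hu] at h4
      rwa [h4] at h3
    rw [← derChart_derChartSymm he hu v, h1, map_zero]
  have hfin : Module.finrank ℝ (Model n) = Module.finrank ℝ (Model n →L[ℝ] ℝ) := by
    rw [← (LinearMap.toContinuousLinearMap (𝕜 := ℝ) (E := Model n) (F' := ℝ)).finrank_eq]
    exact (Subspace.dual_finrank_eq (K := ℝ) (V := Model n)).symm
  exact ⟨(LinearEquiv.ofInjectiveOfFinrankEq _ hinj hfin).toContinuousLinearEquiv, by ext; rfl⟩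

/-- The Hamiltonian vector field of a function `f` in a chart; meaningful on `e.target`, where the
form is nondegenerate. -/
def localField (Ω : SymplecticForm n Y) (e : OpenPartialHomeomorph Y (Model n))
    (f : Model n → ℝ) (u : Model n) : Model n :=
  (curryTwo (Model n) (localForm Ω.form e u)).inverse (-fderiv ℝ f u)

lemma localForm_localField (he : e ∈ charts n Y) {u : Model n} (hu : u ∈ e.target)
    (f : Model n → ℝ) (w : Model n) :
    localForm Ω.form e u ![localField Ω e f u, w] = -fderiv ℝ f u w :=
  congrArg (fun A : Model n →L[ℝ] ℝ => A w)
    ((isInvertible_curryTwo_localForm (Ω := Ω) he hu).self_apply_inverse (-fderiv ℝ f u))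

lemma localField_eq_zero {f : Model n → ℝ} {u : Model n} (hu : u ∉ tsupport f) :
    localField Ω e f u = 0 := by
  have h : fderiv ℝ f u = 0 := by
    by_contra hne
    exact hu (tsupport_fderiv_subset ℝ (subset_tsupport _ hne))
  rw [localField, h, neg_zero, map_zero]

lemma contDiff_localField (he : e ∈ charts n Y) {f : Model n → ℝ} (hf : ContDiff ℝ ∞ f)
    (hs : tsupport f ⊆ e.target) : ContDiff ℝ ∞ (localField Ω e f) := by
  rw [contDiff_iff_contDiffAt]
  intro u
  by_cases hu : u ∈ tsupport f
  · have hut := hs hu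
    obtain ⟨B, hB⟩ := isInvertible_curryTwo_localForm (Ω := Ω) he hut
    have hc : ContDiff ℝ ∞ (curryTwo (Model n)) := ContinuousLinearMap.contDiff (𝕜 := ℝ)
      (E := Model n [⋀^Fin 2]→L[ℝ] ℝ) (F := Model n →L[ℝ] Model n →L[ℝ] ℝ) (curryTwo (Model n))
    have h1 : ContDiffAt ℝ ∞ (fun u => curryTwo (Model n) (localForm Ω.form e u)) u :=
      ContDiffAt.comp (g := curryTwo (Model n)) u hc.contDiffAt
        ((Ω.smooth e he).contDiffAt (e.open_target.mem_nhds hut))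
    have h2 : ContDiffAt ℝ ∞ ContinuousLinearMap.inverse
        (curryTwo (Model n) (localForm Ω.form e u)) := by
      rw [← hB]
      exact contDiffAt_map_inverse B
    exact (h2.comp u h1).clm_apply (hf.fderiv_right (by simp)).neg.contDiffAt
  · refine contDiffAt_const (c := (0 : Model n)) |>.congr_of_eventuallyEq ?_
    filter_upwards [(isClosed_tsupport f).isOpen_compl.mem_nhds hu] with z hz
    exact localField_eq_zero hz

lemma hasCompactSupport_localField {f : Model n → ℝ} (hf : HasCompactSupport f) :
    HasCompactSupport (localField Ω e f) :=
  hf.mono' fun u hu => by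
    by_contra h
    exact hu (localField_eq_zero h)

/-- A map of the model space which is the identity off a subset of the target of `e`, transported
to the manifold and extended by the identity. -/
def transport (e : OpenPartialHomeomorph Y (Model n)) (Φ : ℝ × Model n → Model n) (p : ℝ × Y) : Y :=
  open Classical in if p.2 ∈ e.source then e.symm (Φ (p.1, e p.2)) else p.2

section Transport

variable {S : Set (Model n)} {T : ℝ} {Φ : ℝ × Model n → Model n}

omit [ChartedSpace (Model n) Y] in
lemma transport_of_mem {r : ℝ} {y : Y} (hy : y ∈ e.source) :
    transport e Φ (r, y) = e.symm (Φ (r, e y)) := if_pos hy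

omit [ChartedSpace (Model n) Y] in
lemma transport_of_notMem (hΦ : ∀ r u, |r| < T → u ∉ S → Φ (r, u) = u) {r : ℝ} (hr : |r| < T)
    {y : Y} (hy : y ∉ e.symm '' S) : transport e Φ (r, y) = y := by
  by_cases h : y ∈ e.source
  · rw [transport_of_mem h, hΦ r _ hr fun hS => hy ⟨_, hS, e.left_inv h⟩, e.left_inv h]
  · exact if_neg h

omit [ChartedSpace (Model n) Y] in
lemma isClosed_image_symm [T2Space Y] (hS : IsCompact S) (hSe : S ⊆ e.target) :
    IsClosed (e.symm '' S) :=
  (hS.image_of_continuousOn (e.symm.continuousOn.mono hSe)).isClosed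

omit [ChartedSpace (Model n) Y] in
lemma notMem_image_symm (hSe : S ⊆ e.target) {y : Y} (hy : y ∉ e.source) : y ∉ e.symm '' S := by
  rintro ⟨u, hu, rfl⟩
  exact hy (e.map_target (hSe hu))

lemma contMDiffAt_transport [T2Space Y] (he : e ∈ charts n Y) (hS : IsCompact S)
    (hSe : S ⊆ e.target) (hΦ : ∀ r u, |r| < T → u ∉ S → Φ (r, u) = u)
    (hΦe : ∀ r u, |r| < T → u ∈ e.target → Φ (r, u) ∈ e.target)
    (hsm : ∀ p : ℝ × Model n, |p.1| < T → ContDiffAt ℝ ∞ Φ p) {p : ℝ × Y} (hp : |p.1| < T) :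
    ContMDiffAt (𝓘(ℝ, ℝ).prod (𝓡 (2 * n))) (𝓡 (2 * n)) ∞ (transport e Φ) p := by
  obtain ⟨r, y⟩ := p
  by_cases hy : y ∈ e.source
  · have h1 : ContMDiffAt (𝓘(ℝ, ℝ).prod (𝓡 (2 * n))) 𝓘(ℝ, ℝ × Model n) ∞
        (fun q : ℝ × Y => (q.1, e q.2)) (r, y) :=
      contMDiffAt_fst.prodMk_space ((contMDiffAt_chart he hy).comp (r, y) contMDiffAt_snd)
    have h2 : ContMDiffAt (𝓘(ℝ, ℝ).prod (𝓡 (2 * n))) (𝓡 (2 * n)) ∞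
        (fun q : ℝ × Y => Φ (q.1, e q.2)) (r, y) :=
      ContMDiffAt.comp (g := Φ) (r, y) (contMDiffAt_iff_contDiffAt.2 (hsm (r, e y) hp)) h1
    refine (ContMDiffAt.comp (g := e.symm) (r, y)
      (contMDiffAt_chart_symm he (hΦe r _ hp (e.map_source hy))) h2).congr_of_eventuallyEq ?_
    filter_upwards [continuousAt_snd.eventually (e.open_source.mem_nhds hy)] with q hq
    exact transport_of_mem hq
  · refine contMDiffAt_snd.congr_of_eventuallyEq ?_
    have h1 : ∀ᶠ q : ℝ × Y in 𝓝 (r, y), |q.1| < T :=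
      (by fun_prop : Continuous fun q : ℝ × Y => |q.1|).continuousAt.eventually_lt
        continuousAt_const hp
    have h2 : ∀ᶠ q : ℝ × Y in 𝓝 (r, y), q.2 ∉ e.symm '' S :=
      continuousAt_snd.eventually
        ((isClosed_image_symm hS hSe).isOpen_compl.mem_nhds (notMem_image_symm hSe hy))
    filter_upwards [h1, h2] with q hq1 hq2
    exact transport_of_notMem hΦ hq1 hq2

omit [ChartedSpace (Model n) Y] in
lemma transport_neg_transport
    (hΦe : ∀ r u, |r| < T → u ∈ e.target → Φ (r, u) ∈ e.target)
    (hneg : ∀ r u, |r| < T → Φ (-r, Φ (r, u)) = u) {r : ℝ} (hr : |r| < T) (y : Y) :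
    transport e Φ (-r, transport e Φ (r, y)) = y := by
  by_cases hy : y ∈ e.source
  · have h := hΦe r _ hr (e.map_source hy)
    rw [transport_of_mem hy, transport_of_mem (e.map_target h), e.right_inv h, hneg r _ hr,
      e.left_inv hy]
  · have h : transport e Φ (r, y) = y := if_neg hy
    rw [h]
    exact if_neg hy

end Transport

/-- A family of self-maps, smooth for parameters in `(-T, T)`, in which opposite parameters give
inverse maps, defines a smooth family of diffeomorphisms after a change of parameter. -/
lemma exists_smoothFamily {G : ℝ × Y → Y} {T : ℝ}
    (hG : ∀ p : ℝ × Y, |p.1| < T → ContMDiffAt (𝓘(ℝ, ℝ).prod (𝓡 (2 * n))) (𝓡 (2 * n)) ∞ G p)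
    (hneg : ∀ r y, |r| < T → G (-r, G (r, y)) = y) {τ : ℝ → ℝ} (hτ : ContDiff ℝ ∞ τ)
    (hτT : ∀ t, |τ t| < T) :
    ∃ h : ℝ → Diffeo n Y, SmoothFamily h ∧ ∀ t y, h t y = G (τ t, y) := by
  have hG' : ∀ r, |r| < T → ContMDiff (𝓡 (2 * n)) (𝓡 (2 * n)) ∞ fun y => G (r, y) :=
    fun r hr y => ContMDiffAt.comp (g := G) (f := fun y => (r, y)) y (hG (r, y) hr)
      (contMDiffAt_const.prodMk contMDiffAt_id)
  have hτT' : ∀ t, |-τ t| < T := fun t => by rw [abs_neg]; exact hτT t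
  refine ⟨fun t => ⟨⟨fun y => G (τ t, y), fun y => G (-τ t, y), fun y => hneg _ _ (hτT t),
    fun y => ?_⟩, hG' _ (hτT t), hG' _ (hτT' t)⟩, fun p => ?_, fun t y => rfl⟩
  · simpa using hneg (-τ t) y (hτT' t)
  · exact ContMDiffAt.comp (g := G) (f := fun q : ℝ × Y => (τ q.1, q.2)) p (hG _ (hτT p.1))
      ((hτ.contMDiff.comp contMDiff_fst).prodMk contMDiff_snd).contMDiffAt

/-- The flow in the chart `e` of the Hamiltonian vector field of `f`, reparametrised so as to be
defined at all times, is a Hamiltonian path whose initial velocity is that field. -/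
lemma exists_hamiltonian_path_of_localField [T2Space Y] (he : e ∈ charts n Y) {f : Model n → ℝ}
    (hf : ContDiff ℝ ∞ f) (hfc : HasCompactSupport f) (hfe : tsupport f ⊆ e.target) :
    ∃ (H : ℝ → Y → ℝ) (h : ℝ → Diffeo n Y), Generates Ω H h ∧ h 0 = 1 ∧
      ∀ q ∈ e.source, HasDerivAt (fun t => e (h t q)) (localField Ω e f (e q)) 0 := by
  set X := localField Ω e f with hX
  have hXs : ContDiff ℝ ∞ X := contDiff_localField he hf hfe
  have hXc : HasCompactSupport X := hasCompactSupport_localField hfc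
  obtain ⟨K, hK⟩ := hXs.lipschitzWith_of_hasCompactSupport hXc (by simp)
  obtain ⟨T, Φ, hT, hsm, hΦ0, hΦd⟩ := exists_flow hXs hXc
  set S := tsupport f with hS
  have hΦS : ∀ r u, |r| < T → u ∉ S → Φ (r, u) = u := fun r u hr hu =>
    flow_eq_self hK hΦ0 hΦd (localField_eq_zero hu) hr
  have hneg : ∀ r u, |r| < T → Φ (-r, Φ (r, u)) = u := fun r u hr => flow_neg_flow hK hΦ0 hΦd u hr
  have hΦe : ∀ r u, |r| < T → u ∈ e.target → Φ (r, u) ∈ e.target := fun r u hr hu => by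
    by_contra hne
    have hnS : Φ (r, u) ∉ S := fun h => hne (hfe h)
    have h1 := hneg r u hr
    rw [hΦS (-r) _ (by rwa [abs_neg]) hnS] at h1
    rw [h1] at hne
    exact hne hu
  -- a change of time with `τ 0 = 0`, `τ' 0 = 1` and values in `(-T, T)`, where the flow is defined
  set τ : ℝ → ℝ := fun t => T / 2 * Real.sin (2 / T * t) with hτ
  have hτs : ContDiff ℝ ∞ τ := contDiff_const.mul (Real.contDiff_sin.comp (by fun_prop))
  have hτT : ∀ t, |τ t| < T := fun t => by
    rw [hτ, abs_mul, abs_of_pos (half_pos hT)]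
    calc T / 2 * |Real.sin (2 / T * t)| ≤ T / 2 * 1 := by gcongr; exact Real.abs_sin_le_one _
      _ < T := by linarith
  have hτ0 : τ 0 = 0 := by simp [hτ]
  have hτd : HasDerivAt τ 1 0 := by
    have h1 : HasDerivAt (fun t : ℝ => 2 / T * t) (2 / T) 0 := by
      simpa using (hasDerivAt_id (0 : ℝ)).const_mul (2 / T)
    have h2 := (h1.sin).const_mul (T / 2)
    have h3 : T / 2 * (Real.cos (2 / T * 0) * (2 / T)) = 1 := by
      rw [mul_zero, Real.cos_zero]
      field_simp
    rwa [h3] at h2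
  obtain ⟨h, hh, hG⟩ := exists_smoothFamily
    (fun p hp => contMDiffAt_transport he hfc hfe hΦS hΦe hsm hp)
    (fun r y hr => transport_neg_transport hΦe hneg hr y) hτs hτT
  have heh : ∀ q ∈ e.source, ∀ t, h t q ∈ e.source ∧ e (h t q) = Φ (τ t, e q) := by
    intro q hq t
    have hm := hΦe (τ t) _ (hτT t) (e.map_source hq)
    rw [hG, transport_of_mem hq]
    exact ⟨e.map_target hm, e.right_inv hm⟩
  have hder : ∀ q ∈ e.source, ∀ t,
      HasDerivAt (fun t => e (h t q)) (deriv τ t • X (Φ (τ t, e q))) t := by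
    intro q hq t
    have h1 := (hΦd (τ t) (e q) (hτT t)).scomp t (hτs.differentiable (by simp) t).hasDerivAt
    exact h1.congr_of_eventuallyEq (Eventually.of_forall fun s => (heh q hq s).2)
  -- the Hamiltonian `f ∘ e`, extended by zero
  classical
  set F : Y → ℝ := fun y => if y ∈ e.source then f (e y) else 0 with hF
  have hFz : ∀ y, y ∉ e.symm '' S → F y = 0 := fun y hy => by
    by_cases hys : y ∈ e.source
    · rw [hF]
      simp only [hys, if_true]
      exact image_eq_zero_of_notMem_tsupport fun hS => hy ⟨_, hS, e.left_inv hys⟩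
    · exact if_neg hys
  have hFe : ∀ y ∈ e.source, F =ᶠ[𝓝 y] fun z => f (e z) := fun y hy => by
    filter_upwards [e.open_source.mem_nhds hy] with z hz using if_pos hz
  have hFz' : ∀ y, y ∉ e.source → F =ᶠ[𝓝 y] fun _ => 0 := fun y hy => by
    filter_upwards [(isClosed_image_symm hfc hfe).isOpen_compl.mem_nhds
      (notMem_image_symm hfe hy)] with z hz using hFz z hz
  have hFs : ContMDiff (𝓡 (2 * n)) 𝓘(ℝ, ℝ) ∞ F := by
    intro y
    by_cases hy : y ∈ e.source
    · exact (hf.contMDiff.contMDiffAt.comp y (contMDiffAt_chart he hy)).congr_of_eventuallyEq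
        (hFe y hy)
    · exact contMDiffAt_const.congr_of_eventuallyEq (hFz' y hy)
  have hFm : ∀ y, MDifferentiableAt (𝓡 (2 * n)) 𝓘(ℝ, ℝ) F y :=
    fun y => hFs.contMDiffAt.mdifferentiableAt (by simp)
  refine ⟨fun t y => deriv τ t * F y, h, .of_pair hh ?_ fun t y w => ?_, ?_, fun q hq => ?_⟩
  · exact ((contDiff_infty_iff_deriv.1 hτs).2.contMDiff.comp contMDiff_fst).mul
      (hFs.comp contMDiff_snd)
  · rw [differential_const_mul (hFm _)]
    by_cases hy : y ∈ e.source
    · obtain ⟨hs, he2⟩ := heh y hy t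
      have h1 : derChart e (h t y) (velocity h t y) = deriv τ t • X (e (h t y)) := by
        have h2 := mfderiv_comp (I := 𝓘(ℝ, ℝ)) (I' := 𝓡 (2 * n)) (I'' := 𝓡 (2 * n)) t
          (mdiffAt_chart he hs) (hh.mdiffAt_orbit t y)
        rw [mfderiv_eq_fderiv] at h2
        have h3 := congrArg (fun A : ℝ →L[ℝ] Model n => A 1) h2
        refine h3.symm.trans ?_
        rw [he2]
        exact (hder y hy t).deriv
      have h4 : differential F (h t y) w = fderiv ℝ f (e (h t y)) (derChart e (h t y) w) := by
        have h5 := mfderiv_comp (I := 𝓡 (2 * n)) (I' := 𝓡 (2 * n)) (I'' := 𝓘(ℝ, ℝ)) (h t y)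
          (hf.contMDiff.contMDiffAt.mdifferentiableAt (x := e (h t y)) (by simp))
          (mdiffAt_chart he hs)
        rw [mfderiv_eq_fderiv] at h5
        exact congrArg (fun A : Model n →L[ℝ] ℝ => A w) ((hFe _ hs).mfderiv_eq.trans h5)
      rw [← localForm_derChart Ω he hs, h1, h4]
      have h6 := (localForm Ω.form e (e (h t y))).vecCons_smul ![derChart e (h t y) w]
        (deriv τ t) (X (e (h t y)))
      refine h6.trans ?_
      have h7 := localForm_localField (Ω := Ω) he (e.map_source hs) f (derChart e (h t y) w)
      rw [smul_eq_mul, ← mul_neg]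
      exact congrArg _ h7
    · have hc : ∀ s, h s y = y := fun s => by rw [hG]; exact if_neg hy
      have hv : velocity h t y = 0 := by
        have h2 : (fun s => h s y) = fun _ => y := funext hc
        have h3 : mfderiv 𝓘(ℝ, ℝ) (𝓡 (2 * n)) (fun s => h s y) t = 0 := by
          rw [h2]; exact mfderiv_const
        exact congrArg (fun A : ℝ →L[ℝ] Model n => A 1) h3
      have hd : differential F (h t y) w = 0 := by
        rw [hc t]
        exact congrArg (fun A : Model n →L[ℝ] ℝ => A w) ((hFz' y hy).mfderiv_eq.trans mfderiv_const)
      rw [hv, hd, Ω.pair_zero_left]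
      simp
  · ext y
    rw [hG, hτ0]
    by_cases hy : y ∈ e.source
    · rw [transport_of_mem hy, hΦ0, e.left_inv hy]; rfl
    · exact if_neg hy
  · have h1 := hder q hq 0
    rwa [hτd.deriv, one_smul, hτ0, hΦ0] at h1

/-- Points can be moved in any direction by Hamiltonian paths: near the point, take the linear
function dual to the direction, and cut it off inside the chart. -/
theorem exists_hamiltonian_path_with_velocity [T2Space Y] (Ω : SymplecticForm n Y)
    (he : e ∈ charts n Y) {q : Y} (hq : q ∈ e.source) (v : Model n) :
    ∃ (H : ℝ → Y → ℝ) (h : ℝ → Diffeo n Y), Generates Ω H h ∧ h 0 = 1 ∧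
      HasDerivAt (fun t => e (h t q)) v 0 := by
  have hqt : e q ∈ e.target := e.map_source hq
  obtain ⟨ε, hε, hball⟩ := Metric.isOpen_iff.1 e.open_target _ hqt
  let χ : ContDiffBump (e q) := ⟨ε / 4, ε / 2, by positivity, by linarith⟩
  set ℓ : Model n →L[ℝ] ℝ := -curryTwo (Model n) (localForm Ω.form e (e q)) v with hℓ
  set f : Model n → ℝ := fun u => χ u * ℓ u with hf
  have hfs : ContDiff ℝ ∞ f := χ.contDiff.mul ℓ.contDiff
  have hsub : tsupport f ⊆ tsupport χ := tsupport_mul_subset_left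
  have hfc : HasCompactSupport f := χ.hasCompactSupport.mul_right
  have hfe : tsupport f ⊆ e.target := by
    refine (hsub.trans ?_).trans hball
    rw [χ.tsupport_eq]
    exact Metric.closedBall_subset_ball (half_lt_self hε)
  obtain ⟨H, h, g, h0, hd⟩ := exists_hamiltonian_path_of_localField (Ω := Ω) he hfs hfc hfe
  refine ⟨H, h, g, h0, ?_⟩
  have hv : localField Ω e f (e q) = v := by
    have h1 : f =ᶠ[𝓝 (e q)] ℓ := by
      filter_upwards [χ.eventuallyEq_one] with u hu
      simp [hf, hu]
    rw [localField, h1.fderiv_eq, ContinuousLinearMap.fderiv, hℓ, neg_neg]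
    exact (isInvertible_curryTwo_localForm he hqt).inverse_apply_self v
  rw [← hv]
  exact hd q hq

variable [T2Space Y] [IsManifold (𝓡 (2 * n)) ∞ Y]

/-- The Hamiltonian group moves every point into every nonempty open set. Otherwise there would be
an exceptional point that is nearest, in a chart, to some unexceptional one; a Hamiltonian path
moves it nearer, and its orbit stays exceptional. -/
theorem exists_isHam_apply_mem [ConnectedSpace Y] (Ω : SymplecticForm n Y) {U : Set Y}
    (hU : IsOpen U) (hne : U.Nonempty) (y : Y) : ∃ ψ, IsHam Ω ψ ∧ ψ y ∈ U := by
  set B : Set Y := {y | ∃ ψ, IsHam Ω ψ ∧ ψ y ∈ U} with hB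
  have hBo : IsOpen B := by
    rw [isOpen_iff_mem_nhds]
    rintro z ⟨ψ, hψ, hz⟩
    filter_upwards [ψ.continuous.continuousAt (hU.mem_nhds hz)] with w hw using ⟨ψ, hψ, hw⟩
  have hBinv : ∀ ψ z, IsHam Ω ψ → ψ z ∈ B → z ∈ B := by
    rintro ψ z hψ ⟨φ, hφ, hz⟩
    exact ⟨φ * ψ, hφ.mul hψ, hz⟩
  have hBne : B.Nonempty := hne.imp fun z hz => ⟨1, (Generates.const Ω 1).isHam rfl 0, hz⟩
  -- it remains to see that `B` is closed, since `Y` is connected; suppose `q₀ ∈ closure B \ B`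
  have hBc : IsClosed B := by
    rw [← closure_subset_iff_isClosed]
    intro q₀ hq₀
    by_contra hq₀B
    set e := chartAt (Model n) q₀
    have he : e ∈ charts n Y := chartAt_mem_charts q₀
    have hq₀e : q₀ ∈ e.source := mem_chart_source _ _
    obtain ⟨ε, hε, hball⟩ := Metric.isOpen_iff.1 e.open_target _ (e.map_source hq₀e)
    have hnear : ∀ᶠ z in 𝓝 q₀, z ∈ e.source ∧ e z ∈ Metric.ball (e q₀) (ε / 2) :=
      (e.open_source.eventually_mem hq₀e).and
        ((e.continuousAt hq₀e).eventually (Metric.ball_mem_nhds _ (half_pos hε)))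
    obtain ⟨b, ⟨hbe, hbb⟩, hbB⟩ := mem_closure_iff_nhds.1 hq₀ _ hnear
    -- `b ∈ B` is so close to `q₀` that the ball around `b` through `q₀` lies in the chart
    set p := e b with hp
    set r := dist p (e q₀) with hr
    have hrε : r < ε / 2 := hbb
    have hsub : Metric.closedBall p r ⊆ e.target := fun u hu => hball <| by
      rw [Metric.mem_ball]
      calc dist u (e q₀) ≤ dist u p + dist p (e q₀) := dist_triangle _ _ _
        _ < ε / 2 + ε / 2 := add_lt_add ((Metric.mem_closedBall.1 hu).trans_lt hrε) hrε
        _ = ε := add_halves ε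
    set C := Metric.closedBall p r ∩ e.symm ⁻¹' Bᶜ with hC
    have hCc : IsCompact C := by
      refine (isCompact_closedBall p r).of_isClosed_subset ?_ Set.inter_subset_left
      exact (e.symm.continuousOn.mono hsub).preimage_isClosed_of_isClosed Metric.isClosed_closedBall
        hBo.isClosed_compl
    have hCne : C.Nonempty := ⟨e q₀, by rw [Metric.mem_closedBall, dist_comm], by
      rw [Set.mem_preimage, e.left_inv hq₀e]; exact hq₀B⟩
    -- `u` represents a point outside `B` at minimal distance to `b`; push it towards `b`
    obtain ⟨u, ⟨hur, huB⟩, humin⟩ := hCc.exists_isMinOn hCne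
      (continuous_id.dist continuous_const : Continuous fun u => dist u p).continuousOn
    have hut : u ∈ e.target := hsub hur
    have hup : u ≠ p := by
      rintro rfl
      rw [Set.mem_preimage, hp, e.left_inv hbe] at huB
      exact huB hbB
    have hd : 0 < ‖u - p‖ := norm_pos_iff.2 (sub_ne_zero.2 hup)
    obtain ⟨H, h, g, h0, hder⟩ :=
      exists_hamiltonian_path_with_velocity Ω he (e.map_target hut) (p - u)
    have hc0 : e (h 0 (e.symm u)) = u := by rw [h0, Diffeo.one_apply, e.right_inv hut]
    have hclose : ∀ᶠ t in 𝓝[>] (0 : ℝ), dist (e (h t (e.symm u))) p < dist u p := by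
      have h1 := (hasDerivAt_iff_isLittleO.1 hder).bound (half_pos (half_pos hd))
      have h2 : ∀ᶠ t : ℝ in 𝓝 0, t < 1 := eventually_lt_nhds one_pos
      filter_upwards [nhdsWithin_le_nhds h1, nhdsWithin_le_nhds h2, self_mem_nhdsWithin]
        with t ht ht1 ht0
      have ht0' : (0 : ℝ) < t := ht0
      rw [hc0, sub_zero, Real.norm_eq_abs, abs_of_pos ht0'] at ht
      rw [dist_eq_norm, dist_eq_norm]
      have h3 : e (h t (e.symm u)) - p =
          (e (h t (e.symm u)) - u - t • (p - u)) + (1 - t) • (u - p) := by module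
      rw [h3]
      calc _ ≤ ‖e (h t (e.symm u)) - u - t • (p - u)‖ + ‖(1 - t) • (u - p)‖ := norm_add_le _ _
        _ ≤ ‖u - p‖ / 2 / 2 * t + (1 - t) * ‖u - p‖ := by
          rw [norm_smul, Real.norm_eq_abs, abs_of_pos (by linarith : 0 < 1 - t)]
          gcongr
        _ < ‖u - p‖ := by nlinarith [mul_pos ht0' hd]
    have hsource : ∀ᶠ t in 𝓝[>] (0 : ℝ), h t (e.symm u) ∈ e.source := by
      have c : ContinuousAt (fun t => h t (e.symm u)) 0 :=
        (SmoothFamily.mdiffAt_orbit g.smooth_path 0 _).continuousAt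
      refine nhdsWithin_le_nhds (c.eventually (e.open_source.mem_nhds ?_))
      change h 0 (e.symm u) ∈ e.source
      rw [h0]
      exact e.map_target hut
    obtain ⟨t, ht1, ht2⟩ := (hclose.and hsource).exists
    refine huB (hBinv (h t) _ (g.isHam h0 t) ?_)
    by_contra hne
    have hmem : e (h t (e.symm u)) ∈ C :=
      ⟨(ht1.trans_le (Metric.mem_closedBall.1 hur)).le, by
        rw [Set.mem_preimage, e.left_inv ht2]; exact hne⟩
    exact absurd (humin hmem) (not_le.2 ht1)
  have h := IsClopen.eq_univ ⟨hBc, hBo⟩ hBne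
  exact (h ▸ Set.mem_univ y : y ∈ B)

/-- Finitely many Hamiltonian diffeomorphisms suffice to move all points into an open set. They are
listed as an infinite sequence, the identity first. -/
theorem exists_isHam_cover [ConnectedSpace Y] [CompactSpace Y] (Ω : SymplecticForm n Y) {U : Set Y}
    (hU : IsOpen U) (hne : U.Nonempty) : ∃ (m : ℕ) (ψ : ℕ → Diffeo n Y),
      (∀ k, IsHam Ω (ψ k)) ∧ ψ 0 = 1 ∧ ∀ y, ∃ k < m, ψ k y ∈ U := by
  have hone : IsHam Ω 1 := (Generates.const Ω 1).isHam rfl 0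
  obtain ⟨s, hs⟩ := isCompact_univ.elim_finite_subcover
    (fun ψ : {ψ // IsHam Ω ψ} => ψ.1 ⁻¹' U) (fun ψ => hU.preimage ψ.1.continuous) fun y _ => by
      obtain ⟨ψ, hψ, hy⟩ := exists_isHam_apply_mem Ω hU hne y
      exact Set.mem_iUnion.2 ⟨⟨ψ, hψ⟩, hy⟩
  set l : List {ψ // IsHam Ω ψ} := ⟨1, hone⟩ :: s.toList with hl
  refine ⟨l.length, fun k => (l.getD k ⟨1, hone⟩).1, fun k => (l.getD k ⟨1, hone⟩).2, rfl,
    fun y => ?_⟩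
  obtain ⟨ψ, hψs, hψ⟩ := Set.mem_iUnion₂.1 (hs (Set.mem_univ y))
  obtain ⟨k, hk, hkψ⟩ := List.mem_iff_getElem.1
    (List.mem_cons_of_mem (⟨1, hone⟩ : {ψ // IsHam Ω ψ}) (Finset.mem_toList.2 hψs))
  refine ⟨k, hk, ?_⟩
  have hk' : l.getD k ⟨1, hone⟩ = ψ := (List.getD_eq_getElem _ _ hk).trans hkψ
  change (l.getD k ⟨1, hone⟩).1 y ∈ U
  rw [hk']
  exact hψ

end Push

/-! ### The Liouville measure -/

section Liouville

variable {Ω : SymplecticForm n Y} {e e' : OpenPartialHomeomorph Y (Model n)}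

/-- The Gram matrix of an alternating 2-form in the standard basis. -/
def gram (A : Model n [⋀^Fin 2]→L[ℝ] ℝ) : Matrix (Fin (2 * n)) (Fin (2 * n)) ℝ :=
  Matrix.of fun i j => A ![EuclideanSpace.single i 1, EuclideanSpace.single j 1]

lemma gram_eq_toMatrix (A : Model n [⋀^Fin 2]→L[ℝ] ℝ) :
    gram A = LinearMap.toMatrix₂ (EuclideanSpace.basisFun (Fin (2 * n)) ℝ).toBasis
      (EuclideanSpace.basisFun (Fin (2 * n)) ℝ).toBasis (curryTwo (Model n) A).toLinearMap₁₂ := by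
  ext i j
  simp [gram, LinearMap.toMatrix₂_apply]

/-- The Gram determinant of a pulled back form. -/
lemma det_gram_comp (A : Model n [⋀^Fin 2]→L[ℝ] ℝ) (L : Model n →L[ℝ] Model n) :
    (gram (A.compContinuousLinearMap L)).det = L.det ^ 2 * (gram A).det := by
  have h : (curryTwo (Model n) (A.compContinuousLinearMap L)).toLinearMap₁₂ =
      (curryTwo (Model n) A).toLinearMap₁₂.compl₁₂ L.toLinearMap L.toLinearMap := by
    ext v w
    have : (L ∘ ![v, w] : Fin 2 → Model n) = ![L v, L w] := by
      ext i : 1; fin_cases i <;> rfl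
    exact congrArg A this
  rw [gram_eq_toMatrix, gram_eq_toMatrix, h, LinearMap.toMatrix₂_compl₁₂
    (EuclideanSpace.basisFun (Fin (2 * n)) ℝ).toBasis
    (EuclideanSpace.basisFun (Fin (2 * n)) ℝ).toBasis, Matrix.det_mul, Matrix.det_mul,
    Matrix.det_transpose, LinearMap.det_toMatrix]
  change L.det * _ * L.det = _
  ring

lemma liouvilleDensity_eq (u : Model n) :
    liouvilleDensity Ω e u = √|(gram (localForm Ω.form e u)).det| := rfl

lemma det_gram_localForm_ne_zero (he : e ∈ charts n Y) {u : Model n} (hu : u ∈ e.target) :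
    (gram (localForm Ω.form e u)).det ≠ 0 := by
  obtain ⟨B, hB⟩ := isInvertible_curryTwo_localForm (Ω := Ω) he hu
  rw [gram_eq_toMatrix, ← Matrix.separatingLeft_iff_det_ne_zero,
    LinearMap.separatingLeft_toMatrix₂_iff]
  intro v hv
  have h0 : curryTwo (Model n) (localForm Ω.form e u) v = 0 := ContinuousLinearMap.ext hv
  rw [← hB] at h0
  exact B.map_eq_zero_iff.1 h0

lemma liouvilleDensity_pos (he : e ∈ charts n Y) {u : Model n} (hu : u ∈ e.target) :
    0 < liouvilleDensity Ω e u :=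
  Real.sqrt_pos.2 (abs_pos.2 (det_gram_localForm_ne_zero he hu))

lemma continuousOn_liouvilleDensity (he : e ∈ charts n Y) :
    ContinuousOn (liouvilleDensity Ω e) e.target := by
  have h1 : ContinuousOn (localForm Ω.form e) e.target := (Ω.smooth e he).continuousOn
  have h2 : ContinuousOn (fun u => gram (localForm Ω.form e u)) e.target := by
    refine continuousOn_pi.2 fun i => continuousOn_pi.2 fun j => ?_
    exact (ContinuousAlternatingMap.apply ℝ (Model n) ℝ _).continuous.comp_continuousOn h1
  exact Real.continuous_sqrt.comp_continuousOn
    (continuous_abs.comp_continuousOn (Continuous.comp_continuousOn continuous_id.matrix_det h2))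

/-- Change of variables for the Liouville density. -/
lemma liouvilleDensity_transition (he : e ∈ charts n Y) (he' : e' ∈ charts n Y) {u : Model n}
    (hu : u ∈ e.target) (hu' : e.symm u ∈ e'.source) :
    DifferentiableAt ℝ (fun z => e' (e.symm z)) u ∧
    liouvilleDensity Ω e u = |(fderiv ℝ (fun z => e' (e.symm z)) u).det| *
      liouvilleDensity Ω e' (e' (e.symm u)) := by
  have d : MDifferentiableAt (𝓡 (2 * n)) (𝓡 (2 * n)) (fun z => e' (e.symm z)) u :=
    (mdiffAt_chart he' hu').comp u (mdiffAt_chart_symm he hu)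
  refine ⟨d.differentiableAt, ?_⟩
  have h1 := mfderiv_comp (I := 𝓡 (2 * n)) (I' := 𝓡 (2 * n)) (I'' := 𝓡 (2 * n)) u
    (mdiffAt_chart he' hu') (mdiffAt_chart_symm he hu)
  rw [mfderiv_eq_fderiv] at h1
  have h2 : ∀ v, derChartSymm e' (e' (e.symm u)) (fderiv ℝ (fun z => e' (e.symm z)) u v) =
      derChartSymm e u v := fun v => by
    have h3 := congrArg (fun A : Model n →L[ℝ] Model n => A v) h1
    exact (congrArg _ h3).trans (derChartSymm_derChart he' hu' _)
  have h3 : localForm Ω.form e u = (localForm Ω.form e' (e' (e.symm u))).compContinuousLinearMap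
      (fderiv ℝ (fun z => e' (e.symm z)) u) := by
    ext v
    have hv : v = ![v 0, v 1] := by ext i : 1; fin_cases i <;> rfl
    have : (fderiv ℝ (fun z => e' (e.symm z)) u ∘ ![v 0, v 1] : Fin 2 → Model n) =
        ![fderiv ℝ (fun z => e' (e.symm z)) u (v 0),
          fderiv ℝ (fun z => e' (e.symm z)) u (v 1)] := by
      ext i : 1; fin_cases i <;> rfl
    rw [hv, ContinuousAlternatingMap.compContinuousLinearMap_apply, this, localForm_apply,
      localForm_apply, h2, h2, e'.left_inv hu']
  rw [liouvilleDensity_eq, liouvilleDensity_eq, h3, det_gram_comp, abs_mul, abs_pow, sq_abs,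
    Real.sqrt_mul (sq_nonneg _), Real.sqrt_sq_eq_abs]

variable [MeasurableSpace Y] [BorelSpace Y]

omit [MeasurableSpace Y] [BorelSpace Y] in
lemma aemeasurable_liouvilleDensity (he : e ∈ charts n Y) :
    AEMeasurable (fun u => ENNReal.ofReal (liouvilleDensity Ω e u))
      ((volume : Measure (Model n)).restrict e.target) :=
  ((continuousOn_liouvilleDensity he).aemeasurable e.open_target.measurableSet).ennreal_ofReal

omit [ChartedSpace (Model n) Y] in
lemma measurableSet_target_inter_preimage {A : Set Y} (hA : MeasurableSet A) :
    MeasurableSet (e.target ∩ e.symm ⁻¹' A) := by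
  have h : Measurable (e.target.domRestrict e.symm) :=
    (continuousOn_iff_continuous_domRestrict.1 e.symm.continuousOn).measurable
  have h2 := e.open_target.measurableSet.subtype_image (h hA)
  convert h2 using 1
  ext u
  simp only [Set.mem_inter_iff, Set.mem_preimage, Set.mem_image, Subtype.exists, exists_and_right,
    exists_eq_right]
  exact ⟨fun h => ⟨h.1, h.2⟩, fun ⟨h1, h2⟩ => ⟨h1, h2⟩⟩

omit [ChartedSpace (Model n) Y] in
lemma aemeasurable_chart_symm {ρ : Model n → ENNReal} : AEMeasurable e.symm
    (((volume : Measure (Model n)).restrict e.target).withDensity ρ) :=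
  (e.symm.continuousOn.aemeasurable e.open_target.measurableSet).mono_ac
    (withDensity_absolutelyContinuous _ _)

lemma chartMeasure_apply {A : Set Y} (hA : MeasurableSet A) : chartMeasure Ω e A =
    ∫⁻ u in e.target ∩ e.symm ⁻¹' A, ENNReal.ofReal (liouvilleDensity Ω e u) := by
  rw [chartMeasure, Measure.map_apply_of_aemeasurable aemeasurable_chart_symm hA,
    withDensity_apply', Measure.restrict_restrict' e.open_target.measurableSet, Set.inter_comm]

/-- On the domain of the chart `e`, no other chart gives more mass than `e`, by the change of
variables formula. -/
lemma chartMeasure_le (he : e ∈ charts n Y) (he' : e' ∈ charts n Y) {A : Set Y}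
    (hA : MeasurableSet A) (hAe : A ⊆ e.source) : chartMeasure Ω e' A ≤ chartMeasure Ω e A := by
  set D := e.target ∩ e.symm ⁻¹' (A ∩ e'.source) with hD
  have hDm : MeasurableSet D :=
    measurableSet_target_inter_preimage (hA.inter e'.open_source.measurableSet)
  have himage : e'.target ∩ e'.symm ⁻¹' A = (fun z => e' (e.symm z)) '' D := by
    ext w
    constructor
    · rintro ⟨hw, hwA⟩
      have hwe := hAe hwA
      refine ⟨e (e'.symm w), ⟨e.map_source hwe, ?_⟩, ?_⟩
      · rw [Set.mem_preimage, e.left_inv hwe]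
        exact ⟨hwA, e'.map_target hw⟩
      · simp only [e.left_inv hwe, e'.right_inv hw]
    · rintro ⟨u, ⟨_, huA, hu'⟩, rfl⟩
      refine ⟨e'.map_source hu', ?_⟩
      rw [Set.mem_preimage, e'.left_inv hu']
      exact huA
  have hinj : Set.InjOn (fun z => e' (e.symm z)) D := fun u hu w hw h =>
    e.symm.injOn hu.1 hw.1 (e'.injOn hu.2.2 hw.2.2 h)
  rw [chartMeasure_apply hA, chartMeasure_apply hA, himage,
    lintegral_image_eq_lintegral_abs_det_fderiv_mul volume hDm (fun u hu =>
      (liouvilleDensity_transition (Ω := Ω) he he' hu.1 hu.2.2).1.hasFDerivAt.hasFDerivWithinAt)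
      hinj]
  calc ∫⁻ u in D, ENNReal.ofReal |(fderiv ℝ (fun z => e' (e.symm z)) u).det| *
        ENNReal.ofReal (liouvilleDensity Ω e' (e' (e.symm u)))
      = ∫⁻ u in D, ENNReal.ofReal (liouvilleDensity Ω e u) := by
        refine setLIntegral_congr_fun hDm fun u hu => ?_
        rw [(liouvilleDensity_transition he he' hu.1 hu.2.2).2, ENNReal.ofReal_mul (abs_nonneg _)]
    _ ≤ _ := by
        have hsub : D ⊆ e.target ∩ e.symm ⁻¹' A := fun u hu => ⟨hu.1, hu.2.1⟩
        exact lintegral_mono_set hsub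

/-- Every point has a neighbourhood of finite measure in a chart. -/
lemma exists_chartMeasure_lt_top [IsManifold (𝓡 (2 * n)) ∞ Y] (Ω : SymplecticForm n Y) (y : Y) :
    ∃ e ∈ charts n Y, ∃ N : Set Y, IsOpen N ∧ y ∈ N ∧ N ⊆ e.source ∧ chartMeasure Ω e N < ⊤ := by
  set e := chartAt (Model n) y
  have he : e ∈ charts n Y := chartAt_mem_charts y
  have hy : y ∈ e.source := mem_chart_source _ _
  obtain ⟨ε, hε, hball⟩ := Metric.nhds_basis_closedBall.mem_iff.1
    (e.open_target.mem_nhds (e.map_source hy))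
  refine ⟨e, he, e.source ∩ e ⁻¹' Metric.ball (e y) ε, e.isOpen_inter_preimage Metric.isOpen_ball,
    ⟨hy, Metric.mem_ball_self hε⟩, Set.inter_subset_left, ?_⟩
  rw [chartMeasure_apply (e.isOpen_inter_preimage Metric.isOpen_ball).measurableSet]
  have hsub : e.target ∩ e.symm ⁻¹' (e.source ∩ e ⁻¹' Metric.ball (e y) ε) ⊆
      Metric.closedBall (e y) ε := by
    rintro u ⟨hu, _, hu2⟩
    rw [Set.mem_preimage, e.right_inv hu] at hu2
    exact Metric.ball_subset_closedBall hu2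
  refine (lintegral_mono_set hsub).trans_lt ?_
  exact ((continuousOn_liouvilleDensity he).mono hball).integrableOn_compact
    (isCompact_closedBall _ _) |>.lintegral_lt_top

/-- By compactness, finitely many chart domains bound the supremum defining the Liouville measure.
-/
lemma isFiniteMeasure_liouville [IsManifold (𝓡 (2 * n)) ∞ Y] [CompactSpace Y]
    (Ω : SymplecticForm n Y) : IsFiniteMeasure (liouville Ω) := by
  choose e he N hNo hN hNe hfin using exists_chartMeasure_lt_top Ω
  obtain ⟨s, hs⟩ := isCompact_univ.elim_finite_subcover N hNo
    fun y _ => Set.mem_iUnion.2 ⟨y, hN y⟩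
  set μ : Measure Y := ∑ i ∈ s, (chartMeasure Ω (e i)).restrict (N i) with hμ
  have hle : liouville Ω ≤ μ := by
    refine iSup₂_le fun e' he' => Measure.le_iff.2 fun A hA => ?_
    have hcov : A ⊆ ⋃ i ∈ s, A ∩ N i := by
      rw [← Set.inter_iUnion₂]
      exact Set.subset_inter subset_rfl fun y _ => hs trivial
    calc chartMeasure Ω e' A ≤ ∑ i ∈ s, chartMeasure Ω e' (A ∩ N i) :=
          (measure_mono hcov).trans (measure_biUnion_finset_le _ _)
      _ ≤ ∑ i ∈ s, chartMeasure Ω (e i) (A ∩ N i) := Finset.sum_le_sum fun i _ =>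
          chartMeasure_le (he i) he' (hA.inter (hNo i).measurableSet)
            (Set.inter_subset_right.trans (hNe i))
      _ = μ A := by
          rw [hμ, Measure.finsetSum_apply]
          exact Finset.sum_congr rfl fun i _ => (Measure.restrict_apply hA).symm
  refine ⟨(hle Set.univ).trans_lt ?_⟩
  rw [hμ, Measure.finsetSum_apply]
  refine ENNReal.sum_lt_top.2 fun i _ => ?_
  rw [Measure.restrict_apply_univ]
  exact hfin i

lemma liouville_univ_pos [IsManifold (𝓡 (2 * n)) ∞ Y] [Nonempty Y] (Ω : SymplecticForm n Y) :
    0 < liouville Ω Set.univ := by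
  obtain ⟨y⟩ := ‹Nonempty Y›
  set e := chartAt (Model n) y
  have he : e ∈ charts n Y := chartAt_mem_charts y
  have hle : chartMeasure Ω e ≤ liouville Ω := le_iSup₂_of_le e he le_rfl
  refine lt_of_lt_of_le ?_ (hle Set.univ)
  rw [chartMeasure_apply MeasurableSet.univ, Set.preimage_univ, Set.inter_univ, pos_iff_ne_zero]
  intro h0
  rw [lintegral_eq_zero_iff' (aemeasurable_liouvilleDensity he)] at h0
  have h1 : ∀ᵐ u ∂(volume : Measure (Model n)).restrict e.target, False := by
    filter_upwards [h0, ae_restrict_mem e.open_target.measurableSet] with u hu hut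
    exact (ENNReal.ofReal_pos.2 (liouvilleDensity_pos (Ω := Ω) he hut)).ne' hu
  rw [ae_iff] at h1
  simp only [not_false_eq_true, Set.ofPred_true, Measure.restrict_apply_univ] at h1
  exact (e.open_target.measure_pos volume ⟨_, e.map_source (mem_chart_source _ y)⟩).ne' h1

/-- The chart `e ∘ φ`. -/
def pullChart (φ : Diffeo n Y) (e : OpenPartialHomeomorph Y (Model n)) :
    OpenPartialHomeomorph Y (Model n) :=
  φ.toHomeomorph.toOpenPartialHomeomorph.trans e

omit [MeasurableSpace Y] [BorelSpace Y] in
lemma pullChart_mem_charts [IsManifold (𝓡 (2 * n)) ∞ Y] (φ : Diffeo n Y) (he : e ∈ charts n Y) :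
    pullChart φ e ∈ charts n Y := by
  refine OpenPartialHomeomorph.mem_maximalAtlas_of_contMDiffOn _ (fun y hy => ?_) fun u hu => ?_
  · have hy' : φ y ∈ e.source := by simpa [pullChart] using hy
    exact ((contMDiffAt_chart he hy').comp y (φ.contMDiff y)).contMDiffWithinAt
  · have hu' : u ∈ e.target := by simpa [pullChart] using hu
    exact (ContMDiffAt.comp u (φ⁻¹.contMDiff _) (contMDiffAt_chart_symm he hu')).contMDiffWithinAt

omit [MeasurableSpace Y] [BorelSpace Y] in
/-- The charts `e` and `e ∘ φ` see the same symplectic form if `φ` is symplectic. -/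
lemma liouvilleDensity_pullChart {φ : Diffeo n Y} (hφ : IsSymplectic Ω φ) (he : e ∈ charts n Y)
    {u : Model n} (hu : u ∈ e.target) :
    liouvilleDensity Ω (pullChart φ e) u = liouvilleDensity Ω e u := by
  have h1 : ∀ v, derChartSymm (pullChart φ e) u v = der φ⁻¹ (e.symm u) (derChartSymm e u v) :=
    fun v => congrArg (fun A : Model n →L[ℝ] Model n => A v)
      (mfderiv_comp (I := 𝓡 (2 * n)) (I' := 𝓡 (2 * n)) (I'' := 𝓡 (2 * n)) u
        (Diffeo.mdiffAt φ⁻¹ (e.symm u)) (mdiffAt_chart_symm he hu))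
  have h2 : localForm Ω.form (pullChart φ e) u = localForm Ω.form e u := by
    ext v
    have hv : v = ![v 0, v 1] := by ext i : 1; fin_cases i <;> rfl
    rw [hv, localForm_apply, localForm_apply, h1, h1]
    exact hφ.inv (e.symm u) _ _
  rw [liouvilleDensity_eq, liouvilleDensity_eq, h2]

lemma chartMeasure_pullChart {φ : Diffeo n Y} (hφ : IsSymplectic Ω φ) (he : e ∈ charts n Y) :
    (chartMeasure Ω (pullChart φ e)).map φ = chartMeasure Ω e := by
  have ht : (pullChart φ e).target = e.target := by simp [pullChart]
  ext A hA
  rw [Measure.map_apply φ.continuous.measurable hA,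
    chartMeasure_apply (φ.continuous.measurable hA), chartMeasure_apply hA, ht]
  have hset : e.target ∩ (pullChart φ e).symm ⁻¹' (φ ⁻¹' A) = e.target ∩ e.symm ⁻¹' A := by
    ext u
    refine and_congr_right fun _ => ?_
    change φ (φ⁻¹ (e.symm u)) ∈ A ↔ _
    rw [Diffeo.apply_inv_apply]
    rfl
  rw [hset]
  exact setLIntegral_congr_fun (measurableSet_target_inter_preimage hA)
    fun u hu => by rw [liouvilleDensity_pullChart hφ he hu.1]

/-- Symplectic diffeomorphisms preserve the Liouville measure: they permute the charts. -/
theorem IsSymplectic.map_liouville [IsManifold (𝓡 (2 * n)) ∞ Y] {φ : Diffeo n Y}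
    (hφ : IsSymplectic Ω φ) : (liouville Ω).map φ = liouville Ω := by
  have key : ∀ ψ : Diffeo n Y, IsSymplectic Ω ψ → liouville Ω ≤ (liouville Ω).map ψ := by
    intro ψ hψ
    refine iSup₂_le fun e he => ?_
    rw [← chartMeasure_pullChart hψ he]
    exact Measure.map_mono (le_iSup₂_of_le _ (pullChart_mem_charts ψ he) le_rfl)
      ψ.continuous.measurable
  refine le_antisymm ?_ (key φ hφ)
  have h := Measure.map_mono (key φ⁻¹ hφ.inv) φ.continuous.measurable
  rw [Measure.map_map φ.continuous.measurable (φ⁻¹).continuous.measurable] at h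
  have hid : ⇑φ ∘ ⇑φ⁻¹ = id := funext fun y => Diffeo.apply_inv_apply φ y
  rwa [hid, Measure.map_id] at h

lemma IsSymplectic.integral_comp [IsManifold (𝓡 (2 * n)) ∞ Y] {φ : Diffeo n Y}
    (hφ : IsSymplectic Ω φ) (F : Y → ℝ) : ∫ y, F (φ y) ∂liouville Ω = ∫ y, F y ∂liouville Ω := by
  have h : MeasurePreserving φ (liouville Ω) (liouville Ω) :=
    ⟨φ.continuous.measurable, hφ.map_liouville⟩
  exact h.integral_comp φ.toHomeomorph.measurableEmbedding F

end Liouville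

/-! ### Hamiltonian loops and their classes -/

/-- A smooth family of Hamiltonian diffeomorphisms is a continuous map to `Ham Ω`. -/
lemma SmoothFamily.continuous_ham {P : Type*} [NormedAddCommGroup P] [NormedSpace ℝ P]
    {Ω : SymplecticForm n Y} {L : P → Diffeo n Y} (hL : SmoothFamily L) (hL' : ∀ p, IsHam Ω (L p)) :
    Continuous fun p => (⟨L p, hL' p⟩ : Ham Ω) :=
  continuous_induced_rng.2 hL.continuous

namespace HamLoop

variable [MeasurableSpace Y] {Ω : SymplecticForm n Y}

/-- A normalized Hamiltonian path starting at the identity, periodic together with its Hamiltonian,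
is a Hamiltonian loop. -/
def ofGenerates {H : ℝ → Y → ℝ} {k : ℝ → Diffeo n Y} (g : Generates Ω H k) (k0 : k 0 = 1)
    (hk : ∀ t, k (t + 1) = k t) (hH : ∀ t, H (t + 1) = H t)
    (hn : ∀ t, ∫ y, H t y ∂liouville Ω = 0) : HamLoop Ω where
  loop t := ⟨k t, g.isHam k0 t⟩
  ham := H
  generates := g
  loop_periodic t := Subtype.ext (hk t)
  ham_periodic := hH
  loop_zero := Subtype.ext k0
  normalized := hn

/-- The diffeomorphism at time `t`. -/
def diffeo (h : HamLoop Ω) (t : ℝ) : Diffeo n Y := (h.loop t).1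

variable (h k : HamLoop Ω)

lemma diffeo_periodic (t : ℝ) : h.diffeo (t + 1) = h.diffeo t :=
  congrArg Subtype.val (h.loop_periodic t)

lemma diffeo_zero : h.diffeo 0 = 1 := congrArg Subtype.val h.loop_zero

lemma generates_diffeo : Generates Ω h.ham h.diffeo := h.generates

lemma isHam_diffeo (t : ℝ) : IsHam Ω (h.diffeo t) := (h.loop t).2

lemma smoothFamily_diffeo : SmoothFamily h.diffeo := h.generates.smooth_path

lemma continuous_ham_uncurry : Continuous fun p : ℝ × Y => h.ham p.1 p.2 :=
  h.generates.smooth_ham.continuous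

lemma continuous_ham (t : ℝ) : Continuous (h.ham t) :=
  h.continuous_ham_uncurry.comp (Continuous.prodMk_right t)

/-- The constant loop. -/
def refl (Ω : SymplecticForm n Y) : HamLoop Ω :=
  ofGenerates (Generates.const Ω 1) rfl (fun _ => rfl) (fun _ => rfl) fun _ => by simp

lemma isSymplectic_diffeo [IsManifold (𝓡 (2 * n)) ∞ Y] (t : ℝ) : IsSymplectic Ω (h.diffeo t) :=
  h.generates_diffeo.isSymplectic h.diffeo_zero t

/-- The loop `t ↦ h(mt)`, for an integer `m`. -/
def speed (m : ℤ) : HamLoop Ω :=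
  ofGenerates
    ((h.generates_diffeo.reparam (σ := fun t => m * t)
      (contDiff_const.mul contDiff_id)).congr (K := fun t y => m * h.ham (m * t) y)
      (fun t y => by simp) fun _ => rfl)
    (by simp [diffeo_zero])
    (fun t => by
      have : Function.Periodic h.diffeo 1 := h.diffeo_periodic
      simpa [mul_add] using this.int_mul m (m * t))
    (fun t => by
      have : Function.Periodic h.ham 1 := h.ham_periodic
      have h2 : h.ham (m * t + m) = h.ham (m * t) := by simpa using this.int_mul m (m * t)
      simp [mul_add, h2])
    fun t => by rw [integral_const_mul, h.normalized, mul_zero]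

lemma diffeo_speed (m : ℤ) (t : ℝ) : (h.speed m).diffeo t = h.diffeo (m * t) := rfl

lemma ham_speed (m : ℤ) (t : ℝ) (y : Y) : (h.speed m).ham t y = m * h.ham (m * t) y := rfl

lemma continuous_loop : Continuous h.loop := h.smoothFamily_diffeo.continuous_ham h.isHam_diffeo

/-- The loop as a path in `Ham Ω`. -/
def path : Path (1 : Ham Ω) 1 where
  toFun t := h.loop t
  continuous_toFun := h.continuous_loop.comp continuous_subtype_val
  source' := by simp [h.loop_zero]
  target' := by simpa [h.loop_zero] using h.loop_periodic 0

lemma path_apply (t : unitInterval) : h.path t = ⟨h.diffeo t, h.isHam_diffeo t⟩ := rfl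

/-- The element of `π₁` represented by a loop. -/
def cls : FundamentalGroup (Ham Ω) 1 :=
  FundamentalGroup.fromPath (Path.Homotopic.Quotient.mk h.path)

lemma represents_iff {γ : FundamentalGroup (Ham Ω) 1} : h.Represents γ ↔ h.cls = γ := by
  constructor
  · rintro ⟨p, hp, rfl⟩
    obtain rfl : p = h.path := by ext t; exact hp t
    rfl
  · rintro rfl
    exact ⟨h.path, fun _ => rfl, rfl⟩

lemma cls_congr {h k : HamLoop Ω} (e : ∀ t, h.diffeo t = k.diffeo t) : h.cls = k.cls := by
  have : h.path = k.path := by ext t; exact Subtype.ext (e t)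
  rw [cls, cls, this]

/-- Two paths that are images, under one continuous map defined on a vector space, of paths with the
same end points are homotopic. -/
lemma homotopic_of_lift {X P : Type*} [TopologicalSpace X] [NormedAddCommGroup P] [NormedSpace ℝ P]
    {x y : X} {a b : P} {p q : Path x y} {L : P → X} (hL : Continuous L) (θ θ' : Path a b)
    (hp : ∀ t, p t = L (θ t)) (hq : ∀ t, q t = L (θ' t)) : p.Homotopic q := by
  obtain rfl : x = L a := by simpa using hp 0
  obtain rfl : y = L b := by simpa using hp 1
  obtain rfl : p = θ.map hL := by ext t; exact hp t
  obtain rfl : q = θ'.map hL := by ext t; exact hq t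
  exact (SimplyConnectedSpace.paths_homotopic θ θ').map ⟨L, hL⟩

/-- The straight path in a vector space. -/
def segment {P : Type*} [NormedAddCommGroup P] [NormedSpace ℝ P] (a b : P) : Path a b where
  toFun t := a + (t : ℝ) • (b - a)
  continuous_toFun := by fun_prop
  source' := by simp
  target' := by simp

lemma segment_apply {P : Type*} [NormedAddCommGroup P] [NormedSpace ℝ P] (a b : P)
    (t : unitInterval) : segment a b t = a + (t : ℝ) • (b - a) := rfl

/-- The path `h((1 + m)t)` is homotopic to `h(mt)` followed by `h(t)`: both are images under `h` of
paths from `0` to `1 + m` in `ℝ`. -/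
lemma cls_speed_one_add (m : ℤ) : (h.speed (1 + m)).cls = h.cls * (h.speed m).cls := by
  rw [FundamentalGroup.mul_def]
  refine Path.Homotopic.Quotient.eq.2 ?_
  have hper (s : ℝ) : h.diffeo (m + s) = h.diffeo s := by
    have : Function.Periodic h.diffeo 1 := h.diffeo_periodic
    simpa [add_comm] using this.int_mul m s
  refine homotopic_of_lift h.continuous_loop (segment 0 ((1 + m : ℤ) : ℝ))
    ((segment 0 (m : ℝ)).trans (segment (m : ℝ) ((1 + m : ℤ) : ℝ)))
    (fun t => Subtype.ext ?_) fun t => ?_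
  · change h.diffeo _ = h.diffeo _
    simp [segment_apply, mul_comm]
  · rw [Path.trans_apply, Path.trans_apply]
    split_ifs with ht
    · refine Subtype.ext ?_
      change h.diffeo _ = h.diffeo _
      simp [segment_apply, mul_comm]
    · refine Subtype.ext ?_
      change h.diffeo _ = h.diffeo _
      simp [segment_apply, hper]

lemma cls_refl : (refl Ω).cls = 1 := rfl

lemma cls_speed (m : ℤ) : (h.speed m).cls = h.cls ^ m := by
  have h0 : (h.speed 0).cls = 1 := cls_congr (k := refl Ω) fun t => by
    rw [diffeo_speed, Int.cast_zero, zero_mul, diffeo_zero]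
    rfl
  induction m with
  | zero => rw [h0, zpow_zero]
  | succ m ih => rw [add_comm, cls_speed_one_add, ih, zpow_one_add]
  | pred m ih =>
    have e : (-(m : ℤ)) = 1 + (-m - 1) := by ring
    rw [e, cls_speed_one_add, zpow_one_add] at ih
    exact mul_left_cancel ih

/-! ### Products, inverses and conjugates of Hamiltonian loops -/

variable [CompactSpace Y] [IsManifold (𝓡 (2 * n)) ∞ Y] [BorelSpace Y]

lemma integrable_ham (t : ℝ) : Integrable (h.ham t) (liouville Ω) :=
  have := isFiniteMeasure_liouville Ω
  (h.continuous_ham t).integrable_of_hasCompactSupport (HasCompactSupport.of_compactSpace _)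

/-- The pointwise product of two loops. -/
def mul : HamLoop Ω :=
  ofGenerates (h.generates_diffeo.mul k.generates_diffeo h.isSymplectic_diffeo)
    (by simp [diffeo_zero]) (fun t => by rw [h.diffeo_periodic, k.diffeo_periodic])
    (fun t => by rw [h.ham_periodic, k.ham_periodic, h.diffeo_periodic])
    fun t => by
      have := isFiniteMeasure_liouville Ω
      have hint : Integrable (fun y => k.ham t ((h.diffeo t)⁻¹ y)) (liouville Ω) :=
        ((k.continuous_ham t).comp (h.diffeo t)⁻¹.continuous).integrable_of_hasCompactSupport
          (HasCompactSupport.of_compactSpace _)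
      rw [integral_add (h.integrable_ham t) hint, (h.isSymplectic_diffeo t).inv.integral_comp,
        h.normalized, k.normalized, add_zero]

lemma diffeo_mul (t : ℝ) : (h.mul k).diffeo t = h.diffeo t * k.diffeo t := rfl

lemma ham_mul (t : ℝ) (y : Y) :
    (h.mul k).ham t y = h.ham t y + k.ham t ((h.diffeo t)⁻¹ y) := rfl

/-- The loop of inverses. -/
def inv : HamLoop Ω :=
  ofGenerates (h.generates_diffeo.inv h.isSymplectic_diffeo) (by simp [diffeo_zero])
    (fun t => by rw [h.diffeo_periodic]) (fun t => by rw [h.ham_periodic, h.diffeo_periodic])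
    fun t => by
      rw [integral_neg, (h.isSymplectic_diffeo t).integral_comp, h.normalized, neg_zero]

/-- The conjugate of a loop by a Hamiltonian diffeomorphism. -/
def conj {ψ : Diffeo n Y} (hψ : IsHam Ω ψ) : HamLoop Ω :=
  ofGenerates
    (((Generates.const Ω ψ).mul (h.generates_diffeo.mul (Generates.const Ω ψ⁻¹)
      h.isSymplectic_diffeo) fun _ => hψ.isSymplectic).congr (K := fun t y => h.ham t (ψ⁻¹ y))
      (k := fun t => ψ * h.diffeo t * ψ⁻¹) (fun t y => by simp) fun t => by rw [mul_assoc])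
    (by simp [diffeo_zero]) (fun t => by rw [h.diffeo_periodic])
    (fun t => by rw [h.ham_periodic])
    fun t => by rw [hψ.isSymplectic.inv.integral_comp, h.normalized]

/-- Pointwise multiplication of loops induces the multiplication of classes: the diagonal of the
square is homotopic to two of its sides. -/
lemma cls_mul : (h.mul k).cls = h.cls * k.cls := by
  rw [FundamentalGroup.mul_def]
  refine Path.Homotopic.Quotient.eq.2 ?_
  have hL : Continuous fun p : ℝ × ℝ => (⟨h.diffeo p.1 * k.diffeo p.2,
      (h.isHam_diffeo p.1).mul (k.isHam_diffeo p.2)⟩ : Ham Ω) :=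
    SmoothFamily.continuous_ham
      ((h.smoothFamily_diffeo.comp contDiff_fst).mul (k.smoothFamily_diffeo.comp contDiff_snd)) _
  have hk1 : k.diffeo 1 = 1 := by simpa [diffeo_zero] using k.diffeo_periodic 0
  refine homotopic_of_lift hL (segment (0, 0) (1, 1))
    ((segment (0, 0) (0, 1)).trans (segment (0, 1) (1, 1))) (fun t => Subtype.ext ?_) fun t => ?_
  · simp [segment_apply, path_apply, diffeo_mul]
  · rw [Path.trans_apply, Path.trans_apply]
    split_ifs with ht
    · simp [segment_apply, path_apply, diffeo_zero]
      rfl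
    · simp [segment_apply, path_apply, hk1]
      rfl

lemma cls_inv : h.inv.cls = h.cls⁻¹ := by
  refine eq_inv_of_mul_eq_one_left ?_
  rw [← cls_mul, ← cls_refl]
  exact cls_congr fun t => inv_mul_cancel (h.diffeo t)

omit [CompactSpace Y] in
/-- Conjugation by a Hamiltonian diffeomorphism does not change the class: a path from the identity
to it yields the homotopy. -/
lemma cls_conj {ψ : Diffeo n Y} (hψ : IsHam Ω ψ) : (h.conj hψ).cls = h.cls := by
  obtain ⟨K, k, g, k0, rfl⟩ := id hψ
  refine Path.Homotopic.Quotient.eq.2 (Path.Homotopic.symm ?_)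
  have hk (s : ℝ) : IsHam Ω (k s) := g.isHam k0 s
  have sk : SmoothFamily k := g.smooth_path
  have hL : Continuous fun p : ℝ × ℝ => (⟨k p.1 * h.diffeo p.2 * (k p.1)⁻¹,
      ((hk p.1).mul (h.isHam_diffeo p.2)).mul (hk p.1).inv⟩ : Ham Ω) :=
    SmoothFamily.continuous_ham (((sk.comp contDiff_fst).mul
      (h.smoothFamily_diffeo.comp contDiff_snd)).mul (sk.comp contDiff_fst).inv) _
  have h1 : h.diffeo 1 = 1 := by simpa [diffeo_zero] using h.diffeo_periodic 0
  exact ⟨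
    { toFun := fun p => ⟨k p.1 * h.diffeo p.2 * (k p.1)⁻¹,
        ((hk p.1).mul (h.isHam_diffeo p.2)).mul (hk p.1).inv⟩
      continuous_toFun := hL.comp
        (f := fun p : unitInterval × unitInterval => ((p.1 : ℝ), (p.2 : ℝ))) (by fun_prop)
      map_zero_left := fun t => Subtype.ext (by simp [k0]; rfl)
      map_one_left := fun t => Subtype.ext (by simp; rfl)
      prop' := by
        rintro s t (rfl | rfl)
        · refine Subtype.ext ?_
          change k s * h.diffeo (0 : unitInterval) * (k s)⁻¹ = h.diffeo (0 : unitInterval)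
          simp [diffeo_zero]
        · refine Subtype.ext ?_
          change k s * h.diffeo (1 : unitInterval) * (k s)⁻¹ = h.diffeo (1 : unitInterval)
          simp [h1] }⟩

end HamLoop

/-! ### The Hofer length -/

section SupNorm

variable [CompactSpace Y] {F K : Y → ℝ}

/-- The maximum of `|F|`. -/
def supNorm {Y : Type*} (F : Y → ℝ) : ℝ := ⨆ y, |F y|

lemma supNorm_nonneg {Y : Type*} (F : Y → ℝ) : 0 ≤ supNorm F :=
  Real.iSup_nonneg fun _ => abs_nonneg _

omit [ChartedSpace (Model n) Y] in
lemma abs_le_supNorm (hF : Continuous F) (y : Y) : |F y| ≤ supNorm F :=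
  le_ciSup (f := fun y => |F y|) (isCompact_range hF.abs).bddAbove y

omit [ChartedSpace (Model n) Y] in
lemma exists_abs_eq_supNorm [Nonempty Y] (hF : Continuous F) : ∃ y, |F y| = supNorm F := by
  obtain ⟨y, -, hy⟩ := isCompact_univ.exists_isMaxOn Set.univ_nonempty hF.abs.continuousOn
  exact ⟨y, le_antisymm (abs_le_supNorm hF y) (ciSup_le fun z => hy (Set.mem_univ z))⟩

end SupNorm

namespace HamLoop

variable [MeasurableSpace Y] {Ω : SymplecticForm n Y} (h k : HamLoop Ω)

lemma length_eq : h.length = ∫ t in (0 : ℝ)..1, supNorm (h.ham t) := rfl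

lemma length_nonneg : 0 ≤ h.length :=
  intervalIntegral.integral_nonneg zero_le_one fun _ _ => supNorm_nonneg _

variable [CompactSpace Y]

lemma continuous_supNorm : Continuous fun t => supNorm (h.ham t) := by
  have := isCompact_univ.continuous_sSup (f := fun t y => |h.ham t y|) h.continuous_ham_uncurry.abs
  simp only [Set.image_univ] at this
  exact this

lemma length_speed (m : ℤ) : (h.speed m).length = |(m : ℝ)| * h.length := by
  have h1 (t : ℝ) : supNorm ((h.speed m).ham t) = |(m : ℝ)| * supNorm (h.ham (m * t)) := by
    rw [supNorm, supNorm, Real.mul_iSup_of_nonneg (abs_nonneg _)]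
    exact iSup_congr fun y => by rw [ham_speed, abs_mul]
  simp only [length_eq, h1, intervalIntegral.integral_const_mul]
  rcases eq_or_ne m 0 with rfl | hm
  · simp
  have hm' : (m : ℝ) ≠ 0 := by exact_mod_cast hm
  have hper : Function.Periodic (fun t => supNorm (h.ham t)) 1 := fun t => by
    simp only [h.ham_periodic]
  have h2 := hper.intervalIntegral_add_zsmul_eq m 0
    fun _ _ => h.continuous_supNorm.intervalIntegrable _ _
  rw [intervalIntegral.integral_comp_mul_left (fun t => supNorm (h.ham t)) hm']
  simp only [zero_add, zsmul_eq_mul, mul_one, smul_eq_mul, mul_zero] at h2 ⊢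
  rw [h2, inv_mul_cancel_left₀ hm']

lemma length_mul_le [IsManifold (𝓡 (2 * n)) ∞ Y] [BorelSpace Y] :
    (h.mul k).length ≤ h.length + k.length := by
  simp only [length_eq]
  rw [← intervalIntegral.integral_add (h.continuous_supNorm.intervalIntegrable _ _)
    (k.continuous_supNorm.intervalIntegrable _ _)]
  refine intervalIntegral.integral_mono_on zero_le_one
    ((h.mul k).continuous_supNorm.intervalIntegrable _ _)
    ((h.continuous_supNorm.add k.continuous_supNorm).intervalIntegrable _ _) fun t _ => ?_
  refine Real.iSup_le (fun y => ?_) (add_nonneg (supNorm_nonneg _) (supNorm_nonneg _))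
  exact (abs_add_le _ _).trans
    (add_le_add (abs_le_supNorm (h.continuous_ham t) _) (abs_le_supNorm (k.continuous_ham t) _))

end HamLoop

/-! ### Hofer's norm -/

section Norm

variable [MeasurableSpace Y] {Ω : SymplecticForm n Y} {α β γ : FundamentalGroup (Ham Ω) 1}

lemma hoferNorm_le {h : HamLoop Ω} (hh : h.Represents γ) : hoferNorm γ ≤ h.length :=
  csInf_le ⟨0, by rintro _ ⟨k, -, rfl⟩; exact k.length_nonneg⟩ ⟨h, hh, rfl⟩

lemma hoferNorm_nonneg : 0 ≤ hoferNorm γ :=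
  Real.sInf_nonneg (by rintro _ ⟨k, -, rfl⟩; exact k.length_nonneg)

lemma HamLoop.IsMinimalGeodesic.hoferNorm_eq {h : HamLoop Ω} (hh : h.IsMinimalGeodesic γ) :
    hoferNorm γ = h.length :=
  le_antisymm (hoferNorm_le hh.represents) (le_csInf ⟨_, h, hh.represents, rfl⟩
    (by rintro _ ⟨k, hk, rfl⟩; exact hh.minimal k hk))

lemma HamLoop.Represents.pow {h : HamLoop Ω} (hh : h.Represents γ) (N : ℕ) :
    (h.speed N).Represents (γ ^ N) := by
  rw [HamLoop.represents_iff] at *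
  rw [HamLoop.cls_speed, hh, zpow_natCast]

lemma bddBelow_hoferNorm_div (γ : FundamentalGroup (Ham Ω) 1) :
    BddBelow (Set.range fun k : ℕ => hoferNorm (γ ^ k) / k) :=
  ⟨0, by rintro _ ⟨k, rfl⟩; exact div_nonneg hoferNorm_nonneg k.cast_nonneg⟩

variable [CompactSpace Y] [IsManifold (𝓡 (2 * n)) ∞ Y] [BorelSpace Y]

lemma hoferNorm_mul_le {a b : HamLoop Ω} (ha : a.Represents α) (hb : b.Represents β) :
    hoferNorm (α * β) ≤ hoferNorm α + hoferNorm β := by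
  rw [← sub_le_iff_le_add]
  refine le_csInf ⟨_, a, ha, rfl⟩ ?_
  rintro _ ⟨h, hh, rfl⟩
  rw [sub_le_comm]
  refine le_csInf ⟨_, b, hb, rfl⟩ ?_
  rintro _ ⟨k, hk, rfl⟩
  rw [sub_le_iff_le_add']
  refine (hoferNorm_le ?_).trans (h.length_mul_le k)
  rw [HamLoop.represents_iff] at *
  rw [HamLoop.cls_mul, hh, hk]

lemma HamLoop.Represents.subadditive {h : HamLoop Ω} (hh : h.Represents γ) :
    Subadditive fun k : ℕ => hoferNorm (γ ^ k) := fun k l => by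
  change hoferNorm (γ ^ (k + l)) ≤ hoferNorm (γ ^ k) + hoferNorm (γ ^ l)
  rw [pow_add]
  exact hoferNorm_mul_le (hh.pow k) (hh.pow l)

lemma HamLoop.Represents.tendsto_asymptoticHoferNorm {h : HamLoop Ω} (hh : h.Represents γ) :
    Tendsto (fun k : ℕ => hoferNorm (γ ^ k) / k) atTop (𝓝 (asymptoticHoferNorm γ)) :=
  tendsto_nhds_limUnder ⟨_, hh.subadditive.tendsto_lim (bddBelow_hoferNorm_div γ)⟩

lemma HamLoop.Represents.asymptoticHoferNorm_le {h : HamLoop Ω} (hh : h.Represents γ) {N : ℕ}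
    (hN : N ≠ 0) : asymptoticHoferNorm γ ≤ hoferNorm (γ ^ N) / N := by
  have e := (hh.subadditive.tendsto_lim (bddBelow_hoferNorm_div γ)).limUnder_eq
  exact (le_of_eq e).trans (hh.subadditive.lim_le_div (bddBelow_hoferNorm_div γ) hN)

end Norm

/-! ### Nonconstant loops -/

namespace HamLoop

variable [MeasurableSpace Y] {Ω : SymplecticForm n Y} (h : HamLoop Ω)

/-- A loop with vanishing Hamiltonian is constant, since its trajectories are integral curves of the
zero vector field. -/
lemma loop_eq_one_of_ham_eq_zero [T2Space Y] [IsManifold (𝓡 (2 * n)) ∞ Y]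
    (hH : ∀ t y, h.ham t y = 0) (t : ℝ) : h.loop t = 1 := by
  refine Subtype.ext (Diffeomorph.ext fun y => ?_)
  have : IsManifold (𝓡 (2 * n)) 1 Y := IsManifold.of_le (n := ∞) (by simp)
  have hv (s : ℝ) : velocity h.diffeo s y = 0 := by
    refine Ω.eq_zero_of_pair (y := h.diffeo s y) fun w => ?_
    rw [h.generates_diffeo.pair_velocity, show h.ham s = fun _ => 0 from funext (hH s)]
    have : differential (fun _ : Y => (0 : ℝ)) (h.diffeo s y) w = 0 :=
      congrArg (fun A : Model n →L[ℝ] ℝ => A w) mfderiv_const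
    rw [this, neg_zero]
  have haux (A : ℝ →L[ℝ] Model n) (hA : A 1 = 0) : A = (1 : ℝ →L[ℝ] ℝ).smulRight 0 := by
    ext1; simp [hA]
  have hz : ContMDiff (𝓡 (2 * n)) (𝓡 (2 * n)).tangent 1
      (fun x => (⟨x, 0⟩ : TangentBundle (𝓡 (2 * n)) Y)) :=
    Bundle.contMDiff_zeroSection ℝ (TangentSpace (𝓡 (2 * n)) : Y → Type _)
  have key := isMIntegralCurve_Ioo_eq_of_contMDiff_boundaryless (t₀ := 0)
    (γ := fun s => h.diffeo s y) (γ' := fun _ => y) hz (fun s => ?_) (fun s => ?_)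
    (by simp [diffeo_zero])
  · exact congrFun key t
  · have := (h.smoothFamily_diffeo.mdiffAt_orbit s y).hasMFDerivAt
    have h0 : (mfderiv 𝓘(ℝ, ℝ) (𝓡 (2 * n)) (fun s => h.diffeo s y) s : ℝ →L[ℝ] Model n) =
        (1 : ℝ →L[ℝ] ℝ).smulRight 0 := haux _ (hv s)
    exact h0 ▸ this
  · exact haux 0 rfl ▸ hasMFDerivAt_const (I := 𝓘(ℝ, ℝ)) (I' := 𝓡 (2 * n)) y s

variable [CompactSpace Y] [IsManifold (𝓡 (2 * n)) ∞ Y] [BorelSpace Y]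

/-- A normalized Hamiltonian has a zero at all times, since it cannot have constant sign. -/
lemma exists_ham_eq_zero [ConnectedSpace Y] (t : ℝ) : ∃ y, h.ham t y = 0 := by
  have hfin := isFiniteMeasure_liouville Ω
  have hpos (F : Y → ℝ) (hF : Integrable F (liouville Ω)) (h0 : ∀ y, 0 < F y) :
      0 < ∫ y, F y ∂liouville Ω := by
    rw [integral_pos_iff_support_of_nonneg (fun y => (h0 y).le) hF,
      show Function.support F = Set.univ from Set.eq_univ_of_forall fun y => (h0 y).ne']
    exact liouville_univ_pos Ω
  refine mem_range_of_exists_le_of_exists_ge (h.continuous_ham t) ?_ ?_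
  · by_contra! hc
    exact (hpos _ (h.integrable_ham t) hc).ne' (h.normalized t)
  · by_contra! hc
    refine (hpos _ (h.integrable_ham t).neg fun y => neg_pos.2 (hc y)).ne' ?_
    simp only [Pi.neg_apply]
    rw [integral_neg, h.normalized, neg_zero]

omit [BorelSpace Y] in
lemma exists_supNorm_pos [T2Space Y] (hne : ∃ t, h.loop t ≠ 1) :
    ∃ t ∈ Set.Icc (0 : ℝ) 1, 0 < supNorm (h.ham t) := by
  by_contra! hc
  obtain ⟨t, ht⟩ := hne
  refine ht (h.loop_eq_one_of_ham_eq_zero (fun s y => ?_) t)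
  have hper : Function.Periodic h.ham 1 := h.ham_periodic
  have hs : h.ham s = h.ham (Int.fract s) := by
    have := hper.sub_int_mul_eq ⌊s⌋ (x := s)
    rw [← this, mul_one, Int.self_sub_floor]
  have h1 := hc (Int.fract s) ⟨Int.fract_nonneg s, (Int.fract_lt_one s).le⟩
  rw [← abs_nonpos_iff, hs]
  exact (abs_le_supNorm (h.continuous_ham _) y).trans h1

end HamLoop

/-! ### Sequential shortening -/

section Shortening

variable [MeasurableSpace Y] {Ω : SymplecticForm n Y} [CompactSpace Y]
  [IsManifold (𝓡 (2 * n)) ∞ Y] [BorelSpace Y] (h : HamLoop Ω) (g : ℕ → Ham Ω)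

omit [MeasurableSpace Y] [CompactSpace Y] [BorelSpace Y] in
lemma isHam_conjugators (N : ℕ) : IsHam Ω (conjugators g N) := by
  induction N with
  | zero => exact (1 : Ham Ω).2
  | succ N ih => exact ih.mul (IsHam.inv (g (N + 1)).2)

/-- The loop `f_N = h_0 ⋯ h_{N-1}` with `h_k = φ_k h⁻¹ φ_k⁻¹` as a Hamiltonian loop. -/
def shortenedLoop : ℕ → HamLoop Ω
  | 0 => .refl Ω
  | N + 1 => (shortenedLoop N).mul (h.inv.conj (isHam_conjugators g N))

lemma shortenedLoop_diffeo (N : ℕ) (t : ℝ) :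
    (shortenedLoop h g N).diffeo t = shortened h g N t := by
  induction N with
  | zero => rfl
  | succ N ih => rw [shortenedLoop, HamLoop.diffeo_mul, ih]; rfl

lemma shortenedLoop_cls (N : ℕ) : (shortenedLoop h g N).cls = (h.cls ^ N)⁻¹ := by
  induction N with
  | zero => rw [shortenedLoop, HamLoop.cls_refl, pow_zero, inv_one]
  | succ N ih =>
    rw [shortenedLoop, HamLoop.cls_mul, ih, HamLoop.cls_conj, HamLoop.cls_inv, pow_succ',
      mul_inv_rev]

/-- The points at which the Hamiltonian of `f_N` samples that of `h`:
`z₀ = h(t) y` and `z_k = h(t) g_k z_{k-1}`. -/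
def samplePoint (t : ℝ) (y : Y) : ℕ → Y
  | 0 => h.diffeo t y
  | k + 1 => h.diffeo t ((g (k + 1)).1 (samplePoint t y k))

omit [CompactSpace Y] [IsManifold (𝓡 (2 * n)) ∞ Y] [BorelSpace Y] in
lemma samplePoint_eq (t : ℝ) (y : Y) (k : ℕ) : samplePoint h g t y k =
    h.diffeo t ((conjugators g k)⁻¹ ((shortened h g k t)⁻¹ y)) := by
  induction k with
  | zero => rfl
  | succ k ih =>
    rw [samplePoint, ih]
    simp only [conjugators, shortened, mul_inv_rev, inv_inv, Diffeo.mul_apply,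
      Diffeo.inv_apply_apply]
    rfl

lemma shortenedLoop_ham (N : ℕ) (t : ℝ) (y : Y) : (shortenedLoop h g N).ham t y =
    -∑ k ∈ Finset.range N, h.ham t (samplePoint h g t y k) := by
  induction N with
  | zero => simp [shortenedLoop]; rfl
  | succ N ih =>
    rw [shortenedLoop, HamLoop.ham_mul, ih, Finset.sum_range_succ, samplePoint_eq, neg_add,
      shortenedLoop_diffeo]
    rfl

lemma abs_shortenedLoop_ham_le (N : ℕ) (t : ℝ) (y : Y) :
    |(shortenedLoop h g N).ham t y| ≤ N * supNorm (h.ham t) := by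
  rw [shortenedLoop_ham, abs_neg]
  refine (Finset.abs_sum_le_sum_abs _ _).trans ?_
  refine (Finset.sum_le_sum fun k _ => abs_le_supNorm (h.continuous_ham t) _).trans ?_
  simp

/-- The procedure shortens as soon as, at one time, every sequence of sample points leaves the set
where `|H|` is maximal. -/
lemma length_shortenedLoop_lt [Nonempty Y] {t₀ : ℝ} (ht₀ : t₀ ∈ Set.Icc (0 : ℝ) 1) {m N : ℕ}
    (hmN : m ≤ N)
    (hU : ∀ y, ∃ k < m, |h.ham t₀ (samplePoint h g t₀ y k)| < supNorm (h.ham t₀)) :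
    (shortenedLoop h g N).length < N * h.length := by
  rw [HamLoop.length_eq, HamLoop.length_eq, ← intervalIntegral.integral_const_mul]
  refine intervalIntegral.integral_lt_integral_of_continuousOn_of_le_of_exists_lt zero_lt_one
    (HamLoop.continuous_supNorm _).continuousOn
    (continuous_const.mul h.continuous_supNorm).continuousOn (fun t _ => ?_) ⟨t₀, ht₀, ?_⟩
  · exact ciSup_le fun y => abs_shortenedLoop_ham_le h g N t y
  · obtain ⟨y, hy⟩ := exists_abs_eq_supNorm ((shortenedLoop h g N).continuous_ham t₀)
    obtain ⟨k, hk, hlt⟩ := hU y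
    rw [← hy, shortenedLoop_ham, abs_neg]
    refine (Finset.abs_sum_le_sum_abs _ _).trans_lt ?_
    refine (Finset.sum_lt_sum (fun k _ => abs_le_supNorm (h.continuous_ham t₀) _)
      ⟨k, Finset.mem_range.2 (hk.trans_le hmN), hlt⟩).trans_le ?_
    simp

omit [CompactSpace Y] [BorelSpace Y] in
/-- Any sequence of points `ψ_k(h(t₀) y)`, with `ψ_k` Hamiltonian and `ψ₀ = 1`, is the sequence of
sample points of some shortening procedure. -/
lemma exists_samplePoint_eq (t₀ : ℝ) {ψ : ℕ → Diffeo n Y} (hψ : ∀ k, IsHam Ω (ψ k))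
    (h0 : ψ 0 = 1) :
    ∃ g : ℕ → Ham Ω, ∀ y k, samplePoint h g t₀ y k = ψ k (h.diffeo t₀ y) := by
  refine ⟨fun k => ⟨(h.diffeo t₀)⁻¹ * (ψ k * (ψ (k - 1))⁻¹),
    (h.isHam_diffeo t₀).inv.mul ((hψ _).mul (hψ _).inv)⟩, fun y k => ?_⟩
  induction k with
  | zero => rw [h0]; rfl
  | succ k ih => simp [samplePoint, ih]

/-- A nonconstant loop can be shortened: at a time `t₀` with `H(t₀) ≠ 0`, choose the procedure so
that its sample points meet the open set where `|H(t₀)|` is not maximal. -/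
lemma exists_length_shortenedLoop_lt [T2Space Y] [ConnectedSpace Y] (hne : ∃ t, h.loop t ≠ 1) :
    ∃ (g : ℕ → Ham Ω) (m : ℕ), ∀ N ≥ m, (shortenedLoop h g N).length < N * h.length := by
  obtain ⟨t₀, ht₀, hpos⟩ := h.exists_supNorm_pos hne
  obtain ⟨y₀, hy₀⟩ := h.exists_ham_eq_zero t₀
  have hUo : IsOpen {y | |h.ham t₀ y| < supNorm (h.ham t₀)} :=
    isOpen_lt (h.continuous_ham t₀).abs continuous_const
  obtain ⟨m, ψ, hψ, h0, hcov⟩ := exists_isHam_cover Ω hUo ⟨y₀, by simpa [hy₀] using hpos⟩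
  obtain ⟨g, hg⟩ := exists_samplePoint_eq h t₀ hψ h0
  refine ⟨g, m, fun N hN => length_shortenedLoop_lt h g ht₀ hN fun y => ?_⟩
  obtain ⟨k, hk, hkU⟩ := hcov (h.diffeo t₀ y)
  exact ⟨k, hk, by rw [hg]; exact hkU⟩

end Shortening

end Hofer

end

theorem mainTheorem9 (n : ℕ) (Y : Type*) [TopologicalSpace Y] [T2Space Y] [CompactSpace Y]
    [ConnectedSpace Y] [ChartedSpace (Hofer.Model n) Y] [IsManifold (𝓡 (2 * n)) ∞ Y]
    [MeasurableSpace Y] [BorelSpace Y] (Ω : Hofer.SymplecticForm n Y)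
    (γ : FundamentalGroup (Hofer.Ham Ω) 1) (h : Hofer.HamLoop Ω)
    (hmin : h.IsMinimalGeodesic γ) :
    -- the limit defining the asymptotic norm exists, and it is smaller than the norm
    (Tendsto (fun k : ℕ => Hofer.hoferNorm (γ ^ k) / k) atTop
        (𝓝 (Hofer.asymptoticHoferNorm γ)) ∧
      Hofer.asymptoticHoferNorm γ < Hofer.hoferNorm γ) ∧
    -- the loop `h(Nt)` can be strictly shortened in its class for all large `N`
    (∃ N₀ : ℕ, ∀ N ≥ N₀, ∃ hN : Hofer.HamLoop Ω,
      (∀ t : ℝ, hN.loop t = h.loop (N * t)) ∧ hN.length = N * h.length ∧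
      hN.Represents (γ ^ N) ∧
      ∃ f : Hofer.HamLoop Ω, f.Represents (γ ^ N) ∧ f.length < hN.length) ∧
    -- such a shortening (of the inverse iterate) is given by the sequential procedure
    (∃ (g : ℕ → Hofer.Ham Ω) (N₀ : ℕ), ∀ N ≥ N₀, ∃ f : Hofer.HamLoop Ω,
      (∀ t : ℝ, (f.loop t).1 = Hofer.shortened h g N t) ∧
      f.Represents ((γ ^ N)⁻¹) ∧ f.length < N * h.length) := by
  have hcls := (h.represents_iff).1 hmin.represents
  obtain ⟨g, N₀, hg⟩ := Hofer.exists_length_shortenedLoop_lt h hmin.nonconstant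
  -- reversing `f_N` turns the shortening of the inverse iterate into one of the iterate
  have hrev (N : ℕ) : ((Hofer.shortenedLoop h g N).speed (-1)).Represents (γ ^ N) := by
    rw [Hofer.HamLoop.represents_iff, Hofer.HamLoop.cls_speed, Hofer.shortenedLoop_cls, hcls,
      zpow_neg_one, inv_inv]
  have hlt (N : ℕ) (hN : N₀ ≤ N) :
      ((Hofer.shortenedLoop h g N).speed (-1)).length < N * h.length := by
    simpa [Hofer.HamLoop.length_speed] using hg N hN
  refine ⟨⟨hmin.represents.tendsto_asymptoticHoferNorm, ?_⟩, ⟨N₀, fun N hN => ?_⟩, g, N₀,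
    fun N hN => ?_⟩
  · refine (hmin.represents.asymptoticHoferNorm_le N₀.succ_ne_zero).trans_lt ?_
    rw [div_lt_iff₀ (by positivity), hmin.hoferNorm_eq, mul_comm]
    exact (Hofer.hoferNorm_le (hrev _)).trans_lt (hlt _ N₀.le_succ)
  · have hlen : (h.speed N).length = N * h.length := by simp [Hofer.HamLoop.length_speed]
    refine ⟨h.speed N, fun t => Subtype.ext ?_, hlen, hmin.represents.pow N, _, hrev N, ?_⟩
    · rw [← Int.cast_natCast N]
      rfl
    · rw [hlen]
      exact hlt N hN
  · refine ⟨Hofer.shortenedLoop h g N, Hofer.shortenedLoop_diffeo h g N, ?_, hg N hN⟩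
    rw [Hofer.HamLoop.represents_iff, Hofer.shortenedLoop_cls, hcls]
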